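/- Let $q$ be a prime power and let $m$ be a positive integer with $2\mid m$ and $\gcd(m/2,q-1)=1$. Then there exists a (connected) strongly regular graph with parameters $(N,K,\lambda,\mu)$, where $$N=q^m,\qquad K=\frac{q(q^m-1)}{q+1},$$ $$\lambda=\frac{q^{m+2}-2q^2-3q-(-1)^{m/2}q^{m/2}(1-q)}{(q+1)^2},\qquad \mu=\frac{q\left(q^{m/2}-(-1)^{m/2}\right)\left(q^{m/2+1}+(-1)^{m/2}\right)}{(q+1)^2};$$ in particular $K,\lambda,\mu$ are non-negative integers. More precisely, let $D=\{x\in\mathbb F_{q^m}^*:\operatorname{Tr}_{q^2/q}(\mathrm N_{q^m/q^2}(x))+1=0\}$ and $$\mathcal C_D=\left\{\left(\operatorname{Tr}_{q^m/q}(xd)\right)_{d\in D}:x\in\mathbb F_{q^m}\right\}.$$ Then $\mathcal C_D$ is a linear code over $\mathbb F_q$ of length $|D|=\frac{q(q^m-1)}{q^2-1}$ and dimension $m$. It has exactly two nonzero weights, and it is projective, i.e. every nonzero vector of its dual code has Hamming weight at least $3$. The graph of $\mathcal C_D$ is connected and strongly regular with the parameters above. Here the vertices of the graph of $\mathcal C_D$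 are the vectors of $\mathbb F_q^m$ (the space of columns of a generator matrix of $\mathcal C_D$), and two distinct vertices are adjacent when their difference is a nonzero scalar multiple of a column of the generator matrix. -/

import Mathlib

/-! ## Linear codes -/

section Codes

variable {F ι : Type*} [Field F] [Fintype ι]

open Classical in
/-- The number `A_w` of codewords of Hamming weight `w` in the linear code `C`. -/
noncomputable def weightCount (C : Submodule F (ι → F)) (w : ℕ) : ℕ :=
  Nat.card {c : C // hammingNorm (c : ι → F) = w}

/-- `C` is a two-weight code: exactly two of `A_1, …, A_n` are nonzero, `n` being the length. -/
def IsTwoWeight (C : Submodule F (ι → F)) : Prop :=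
  {w : ℕ | 1 ≤ w ∧ w ≤ Fintype.card ι ∧ weightCount C w ≠ 0}.ncard = 2

/-- The dual code: all vectors orthogonal to `C` for the standard dot product. -/
def dualCode (C : Submodule F (ι → F)) : Submodule F (ι → F) where
  carrier := {v | ∀ c ∈ C, v ⬝ᵥ c = 0}
  add_mem' := by
    intro a b ha hb c hc
    rw [add_dotProduct, ha c hc, hb c hc, add_zero]
  zero_mem' := by
    intro c _
    exact zero_dotProduct c
  smul_mem' := by
    intro r a ha c hc
    rw [smul_dotProduct, ha c hc, smul_zero]

open Classical in
/-- `C` is projective: the minimum distance of its dual code is at least `3`. -/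
def IsProjectiveCode (C : Submodule F (ι → F)) : Prop :=
  ∀ v ∈ dualCode C, v ≠ 0 → 3 ≤ hammingNorm v

/-- The `i`-th coordinate as a linear functional on the code `C`. With respect to a basis of `C`,
i.e. for a generator matrix of `C`, its coordinate vector is the `i`-th column of that matrix. -/
def coordFunctional (C : Submodule F (ι → F)) (i : ι) : Module.Dual F C :=
  (LinearMap.proj i).comp C.subtype

/-- The graph of a linear code `C` of dimension `k`. Its vertices are the elements of the
`k`-dimensional space dual to `C` (column vectors of length `k`, once a basis of `C` is chosen),
and two distinct vertices are adjacent when their difference is a nonzero scalar multiple of a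
column of the generator matrix. -/
def codeGraph (C : Submodule F (ι → F)) : SimpleGraph (Module.Dual F C) where
  Adj φ ψ := φ ≠ ψ ∧ ∃ u : F, u ≠ 0 ∧ ∃ i : ι, φ - ψ = u • coordFunctional C i
  symm := ⟨by
    rintro φ ψ ⟨hne, u, hu, i, h⟩
    exact ⟨hne.symm, -u, neg_ne_zero.mpr hu, i, by
      rw [← neg_sub φ ψ, h]
      exact (neg_smul u _).symm⟩⟩
  loopless := ⟨fun _ h => h.1 rfl⟩

end Codes

/-! ## The trace-norm codes -/

section TraceNorm

variable (F E₁ E₂ L : Type*) [Field F] [Field E₁] [Field E₂] [Field L] [Fintype L]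
  [Algebra F E₁] [Algebra F E₂] [Algebra E₁ L] [Algebra E₂ L]

open Classical in
/-- The defining set `D = {x ∈ L* : Tr_{E₂/F}(N_{L/E₂}(x)) + a = 0}`. -/
noncomputable def definingSet (a : F) : Finset L :=
  Finset.univ.filter fun x => x ≠ 0 ∧ Algebra.trace F E₂ (Algebra.norm E₂ x) + a = 0

/-- The encoding map `x ↦ (Tr_{E₁/F}(x N_{L/E₁}(d)))_{d ∈ D}` on `E₁`. -/
noncomputable def traceNormMap (a : F) : E₁ →ₗ[F] (definingSet F E₂ L a → F) :=
  LinearMap.pi fun d =>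
    (Algebra.trace F E₁).comp (LinearMap.mulRight F (Algebra.norm E₁ (d : L)))

/-- The code `C_D = {(Tr_{E₁/F}(x N_{L/E₁}(d)))_{d ∈ D} : x ∈ E₁}`. -/
noncomputable def traceNormCode (a : F) : Submodule F (definingSet F E₂ L a → F) :=
  LinearMap.range (traceNormMap F E₁ E₂ L a)

end TraceNorm

/-! ## Strongly regular graphs -/

/-- `G` is a (finite) connected strongly regular graph with parameters `(N, K, lam, mu)`. -/
def IsStronglyRegular {V : Type*} (G : SimpleGraph V) (N K lam mu : ℕ) : Prop :=
  G.Connected ∧ ∃ (_ : Fintype V) (_ : DecidableEq V) (_ : DecidableRel G.Adj),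
    G.IsSRGWith N K lam mu

/-! ### Power maps on the cyclic group of a finite field -/

section PowerEquations

/-! Write `m = 2k`, with tower `F ⊂ E ⊂ L` of sizes `q`, `q^2`, `q^(2k)`, and let `S` be the set of
`x` in `L` with `Tr(N(x)) ≠ 0`. Since `Tr(β) = β + β^q` and the norm is a power map, the nonzero
zeros of `Tr ∘ N` are one coset `z₀ H` of the group `H` of `(q+1)`-st powers
(`traceNormZeros_eq_image`). The Fourier coefficients of `S` therefore reduce to the sums `g(c) = ∑
χ(Tr(c y^(q+1)))` (`sum_traceChar_support`).

For `c ≠ 0`, `g(c)` is an integer congruent to 1 mod `q+1`, and `g(c)^2 = g(c) g(-c)` is `q^(2k)`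
times the size, 1 or `q^2`, of the radical of the form. The congruence fixes the sign, leaving
`(-1)^k q^k` and `-(-1)^k q^(k+1)` (`hermSum_eq_or`). Thus `S` has two nontrivial Fourier
coefficients, and Fourier inversion makes the Cayley graph of `(L, S)` strongly regular
(`card_filter_sub_mem_of_fourier`, `isStronglyRegular_of_equiv`).

Scaling `x` by `u` in `F` multiplies `Tr(N(x))` by `u^k`, and `gcd(k, q-1) = 1` makes `u ↦ u^k`
bijective on `F`. So `D` meets each punctured `F`-line of `S` exactly once. This makes the code
projective, expresses its weights through `g`, and identifies its graph with that Cayley graph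
(`exists_codeGraph_equiv`). -/

open scoped Classical in
theorem card_filter_pow_eq_one {L : Type*} [Field L] [Fintype L] {d : ℕ}
    (hd : d ∣ Fintype.card L - 1) : (Finset.univ.filter fun t : L => t ^ d = 1).card = d := by
  have h1 : 1 < Fintype.card L := Fintype.one_lt_card
  have hd0 : d ≠ 0 := by
    rintro rfl
    have := Nat.eq_zero_of_zero_dvd hd
    omega
  have h := IsCyclic.card_powMonoidHom_ker (G := Lˣ) d
  rw [Nat.card_units, Nat.card_eq_fintype_card (α := L), Nat.gcd_eq_right hd] at h
  rw [← Fintype.card_subtype, ← Nat.card_eq_fintype_card]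
  let e : {t : L // t ^ d = 1} ≃ (powMonoidHom d : Lˣ →* Lˣ).ker :=
    { toFun := fun t => ⟨Units.mk0 t.1 fun h0 => zero_ne_one (by
          have := t.2
          rwa [h0, zero_pow hd0] at this), by
        rw [MonoidHom.mem_ker]
        ext
        simpa using t.2⟩
      invFun := fun u => ⟨(u.1 : L), by
        have := u.2
        rw [MonoidHom.mem_ker] at this
        simpa using congrArg Units.val this⟩
      left_inv := fun t => rfl
      right_inv := fun u => by ext; rfl }
  exact (Nat.card_congr e).trans h

open scoped Classical in
theorem card_filter_pow_eq_pow {L : Type*} [Field L] [Fintype L] {d : ℕ}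
    (hd : d ∣ Fintype.card L - 1) {a : L} (ha : a ≠ 0) :
    (Finset.univ.filter fun t : L => t ^ d = a ^ d).card = d := by
  conv_rhs => rw [← card_filter_pow_eq_one hd]
  refine Finset.card_bij' (fun t _ => t / a) (fun t _ => t * a) ?_ ?_ ?_ ?_
  · intro t ht
    simp only [Finset.mem_filter, Finset.mem_univ, true_and] at ht ⊢
    rw [div_pow, ht, div_self (pow_ne_zero _ ha)]
  · intro t ht
    simp only [Finset.mem_filter, Finset.mem_univ, true_and] at ht ⊢
    rw [mul_pow, ht, one_mul]
  · intro t _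
    exact div_mul_cancel₀ t ha
  · intro t _
    exact mul_div_cancel_right₀ t ha

/-- For a generator `g` of order `d * M` and `x = g ^ j`, the relation `g ^ (j * M) = 1` forces `d ∣
j`. -/
theorem exists_pow_eq_of_pow_eq_one {L : Type*} [Field L] [Fintype L] {d M : ℕ}
    (hdM : Fintype.card L - 1 = d * M) {x : L} (hx : x ^ M = 1) :
    ∃ y : L, y ≠ 0 ∧ y ^ d = x := by
  classical
  have h1 : 1 < Fintype.card L := Fintype.one_lt_card
  have hM : 0 < M := Nat.pos_of_ne_zero (by rintro rfl; simp at hdM; omega)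
  have hx0 : x ≠ 0 := by
    rintro rfl
    rw [zero_pow hM.ne'] at hx
    exact zero_ne_one hx
  obtain ⟨g, hg⟩ := IsCyclic.exists_generator (α := Lˣ)
  have hord : orderOf g = d * M := by
    rw [orderOf_eq_card_of_forall_mem_zpowers hg, Nat.card_units, Nat.card_eq_fintype_card, hdM]
  obtain ⟨j, hj⟩ := mem_zpowers_iff_mem_range_orderOf.mp (hg (Units.mk0 x hx0)) |>
    Finset.mem_image.mp
  have hpow : g ^ (j * M) = 1 := by
    rw [pow_mul, hj.2]
    ext
    simpa using hx
  have hdvd : d ∣ j := Nat.dvd_of_mul_dvd_mul_right hM (hord ▸ orderOf_dvd_of_pow_eq_one hpow)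
  obtain ⟨i, rfl⟩ := hdvd
  refine ⟨((g ^ i : Lˣ) : L), Units.ne_zero _, ?_⟩
  rw [← Units.val_pow_eq_pow_val, ← pow_mul, mul_comm, hj.2, Units.val_mk0]

open scoped Classical in
/-- The fibres of `y ↦ c * y ^ d` on nonzero elements all have `d` elements. -/
theorem sum_comp_mul_pow {L M : Type*} [Field L] [Fintype L] [AddCommMonoid M] {d : ℕ}
    (hd : d ∣ Fintype.card L - 1) {c : L} (hc : c ≠ 0) (f : L → M) :
    ∑ y ∈ Finset.univ.filter (fun y : L => y ≠ 0), f (c * y ^ d) =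
      d • ∑ z ∈ (Finset.univ.filter (fun y : L => y ≠ 0)).image (fun y => c * y ^ d), f z := by
  have h1 : 1 < Fintype.card L := Fintype.one_lt_card
  have hd0 : d ≠ 0 := by
    rintro rfl
    have := Nat.eq_zero_of_zero_dvd hd
    omega
  rw [Finset.sum_comp f, Finset.smul_sum]
  refine Finset.sum_congr rfl fun z hz => ?_
  congr 1
  obtain ⟨a, ha, rfl⟩ := Finset.mem_image.mp hz
  have ha0 : a ≠ 0 := by simpa using ha
  rw [Finset.filter_filter]
  refine Eq.trans (congrArg Finset.card ?_) (card_filter_pow_eq_pow hd ha0)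
  ext t
  simp only [Finset.mem_filter, Finset.mem_univ, true_and]
  constructor
  · rintro ⟨_, h⟩
    exact mul_left_cancel₀ hc h
  · intro h
    refine ⟨?_, by rw [h]⟩
    rintro rfl
    rw [zero_pow hd0] at h
    exact pow_ne_zero _ ha0 h.symm

end PowerEquations

/-! ### Frobenius and the trace -/

section TraceFacts

variable {F L : Type*} [Field F] [Field L] [Fintype L] [Algebra F L] {q : ℕ}

theorem finite_of_algebra (F L : Type*) [Field F] [Field L] [Finite L] [Algebra F L] : Finite F :=
  Finite.of_injective _ (algebraMap F L).injective

theorem finrank_eq_of_natCard {n : ℕ} (hF : Nat.card F = q) (hL : Nat.card L = q ^ n) :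
    Module.finrank F L = n := by
  have := finite_of_algebra F L
  have h := Module.natCard_eq_pow_finrank (K := F) (V := L)
  rw [hF, hL] at h
  have hq : 2 ≤ q := hF ▸ Finite.one_lt_card
  exact (Nat.pow_right_injective hq h).symm

theorem add_pow_natCard (hF : Nat.card F = q) (x y : L) : (x + y) ^ q = x ^ q + y ^ q := by
  have := finite_of_algebra F L
  let := Fintype.ofFinite F
  have h := map_add (FiniteField.frobeniusAlgHom F L) x y
  rw [Nat.card_eq_fintype_card] at hF
  simpa [hF] using h

theorem neg_pow_natCard (hF : Nat.card F = q) (x : L) : (-x) ^ q = -x ^ q := by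
  have := finite_of_algebra F L
  let := Fintype.ofFinite F
  have h := map_neg (FiniteField.frobeniusAlgHom F L) x
  rw [Nat.card_eq_fintype_card] at hF
  simpa [hF] using h

theorem bijective_pow_natCard (hF : Nat.card F = q) : Function.Bijective fun x : L => x ^ q := by
  have := finite_of_algebra F L
  let := Fintype.ofFinite F
  have h := (FiniteField.frobeniusAlgEquivOfAlgebraic F L).bijective
  rw [Nat.card_eq_fintype_card] at hF
  rwa [FiniteField.coe_frobeniusAlgEquivOfAlgebraic, hF] at h

theorem trace_pow_natCard (hF : Nat.card F = q) (x : L) :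
    Algebra.trace F L (x ^ q) = Algebra.trace F L x := by
  have := finite_of_algebra F L
  let := Fintype.ofFinite F
  have h := Algebra.trace_eq_of_algEquiv (FiniteField.frobeniusAlgEquivOfAlgebraic F L) x
  rw [Nat.card_eq_fintype_card] at hF
  rwa [FiniteField.coe_frobeniusAlgEquivOfAlgebraic, hF] at h

/-- The `2k` conjugates of `v` alternate between `v` and `-v`, so they cancel in pairs. -/
theorem trace_eq_zero_of_pow_eq_neg {k : ℕ} (hF : Nat.card F = q) (hL : Nat.card L = q ^ (2 * k))
    {v : L} (hv : v ^ q = -v) : Algebra.trace F L v = 0 := by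
  apply (algebraMap F L).injective
  rw [FiniteField.algebraMap_trace_eq_sum_pow, finrank_eq_of_natCard hF hL, hF, map_zero]
  have h : ∀ i : ℕ, v ^ q ^ (2 * i) = v := by
    intro i
    induction i with
    | zero => simp
    | succ i ih => rw [Nat.mul_succ, pow_add, pow_mul, ih, pow_two, pow_mul, hv,
        neg_pow_natCard hF, hv, neg_neg]
  clear hL
  induction k with
  | zero => simp
  | succ k ih => rw [Nat.mul_succ, Finset.sum_range_succ, Finset.sum_range_succ, ih, h, pow_succ,
      pow_mul, h, hv]; ring

theorem exists_trace_mul_ne_zero (F : Type*) {L : Type*} [Field F] [Field L] [Finite L]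
    [Algebra F L] {x : L} (hx : x ≠ 0) : ∃ y : L, Algebra.trace F L (x * y) ≠ 0 := by
  have := finite_of_algebra F L
  by_contra! h
  exact hx ((traceForm_nondegenerate F L).1 x fun y => by rw [Algebra.traceForm_apply]; exact h y)

end TraceFacts

/-! ### Exponential sums of `c * y ^ (q + 1)` -/

section CharacterSums

open scoped Classical in
theorem sum_eq_apply_zero_add {A M : Type*} [Fintype A] [Zero A] [AddCommMonoid M] (f : A → M) :
    ∑ x, f x = f 0 + ∑ x ∈ Finset.univ.filter (fun x : A => x ≠ 0), f x := by
  rw [← Finset.add_sum_erase _ f (Finset.mem_univ 0), Finset.filter_ne']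

variable {F L : Type*} [Field F] [Field L] [Algebra F L] {q k : ℕ}

/-- The additive character `χ ∘ Tr` of `L` attached to an additive character `χ` of `F`. -/
noncomputable def traceChar (L : Type*) [Field L] [Algebra F L] (χ : AddChar F ℂ) : AddChar L ℂ :=
  χ.compAddMonoidHom (Algebra.trace F L).toAddMonoidHom

theorem traceChar_apply (χ : AddChar F ℂ) (x : L) :
    traceChar L χ x = χ (Algebra.trace F L x) := rfl

theorem smul_image_fiber_card {A : Finset L} (hA : ∀ u : F, u ≠ 0 → ∀ a ∈ A, u • a ∈ A)
    [DecidableEq F] {u : F} (hu : u ≠ 0) :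
    (A.filter fun a => Algebra.trace F L a = u).card =
      (A.filter fun a => Algebra.trace F L a = 1).card := by
  refine Finset.card_bij' (fun a _ => u⁻¹ • a) (fun a _ => u • a) ?_ ?_ ?_ ?_
  · intro a ha
    rw [Finset.mem_filter] at ha ⊢
    exact ⟨hA _ (inv_ne_zero hu) _ ha.1, by rw [map_smul, ha.2, smul_eq_mul, inv_mul_cancel₀ hu]⟩
  · intro a ha
    rw [Finset.mem_filter] at ha ⊢
    exact ⟨hA _ hu _ ha.1, by rw [map_smul, ha.2, smul_eq_mul, mul_one]⟩
  · intro a _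
    exact smul_inv_smul₀ hu a
  · intro a _
    exact inv_smul_smul₀ hu a

variable [Fintype L]

theorem exists_addChar_ne_one (F : Type*) [Field F] [Finite F] : ∃ χ : AddChar F ℂ, χ ≠ 1 := by
  obtain ⟨χ, h⟩ := AddChar.exists_apply_ne_zero.mpr (one_ne_zero (α := F))
  exact ⟨χ, fun h1 => h (by rw [h1]; rfl)⟩

theorem isPrimitive_traceChar {χ : AddChar F ℂ} (hχ : χ ≠ 1) : (traceChar L χ).IsPrimitive := by
  have := finite_of_algebra F L
  apply AddChar.IsPrimitive.of_ne_one
  obtain ⟨a, ha⟩ := AddChar.ne_one_iff.mp hχ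
  obtain ⟨x, rfl⟩ := Algebra.trace_surjective F L a
  exact AddChar.ne_one_iff.mpr ⟨x, ha⟩

open scoped Classical in
theorem sum_traceChar_mul {χ : AddChar F ℂ} (hχ : χ ≠ 1) (b : L) :
    ∑ x : L, traceChar L χ (b * x) = if b = 0 then (Fintype.card L : ℂ) else 0 := by
  simp_rw [mul_comm b]
  rw [AddChar.sum_mulShift b (isPrimitive_traceChar hχ)]
  split_ifs <;> simp

open scoped Classical in
theorem sum_ne_zero_addChar [Fintype F] {χ : AddChar F ℂ} (hχ : χ ≠ 1) :
    ∑ u ∈ Finset.univ.filter (fun u : F => u ≠ 0), χ u = -1 := by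
  have h := AddChar.sum_eq_zero_of_ne_one hχ
  rw [sum_eq_apply_zero_add, AddChar.map_zero_eq_one] at h
  linear_combination h

/-- The character sum over a set stable under the scalars `Fˣ` is a rational integer. -/
theorem exists_int_sum_traceChar {χ : AddChar F ℂ} (hχ : χ ≠ 1) {A : Finset L}
    (hA : ∀ u : F, u ≠ 0 → ∀ a ∈ A, u • a ∈ A) :
    ∃ n : ℤ, ∑ a ∈ A, traceChar L χ a = n := by
  classical
  have := finite_of_algebra F L
  let := Fintype.ofFinite F
  refine ⟨(A.filter fun a => Algebra.trace F L a = 0).card -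
    (A.filter fun a => Algebra.trace F L a = 1).card, ?_⟩
  have h1 : ∑ a ∈ A, traceChar L χ a =
      ∑ u : F, ((A.filter fun a => Algebra.trace F L a = u).card : ℂ) * χ u := by
    rw [← Finset.sum_fiberwise A (Algebra.trace F L)]
    refine Finset.sum_congr rfl fun u _ => ?_
    rw [← nsmul_eq_mul, ← Finset.sum_const]
    refine Finset.sum_congr rfl fun a ha => ?_
    rw [traceChar_apply, (Finset.mem_filter.mp ha).2]
  rw [h1, sum_eq_apply_zero_add]
  have h2 : ∑ u ∈ Finset.univ.filter (fun u : F => u ≠ 0),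
      ((A.filter fun a => Algebra.trace F L a = u).card : ℂ) * χ u =
      -((A.filter fun a => Algebra.trace F L a = 1).card : ℂ) := by
    rw [← mul_neg_one, ← sum_ne_zero_addChar hχ, Finset.mul_sum]
    refine Finset.sum_congr rfl fun u hu => ?_
    rw [smul_image_fiber_card hA (Finset.mem_filter.mp hu).2]
  rw [h2, AddChar.map_zero_eq_one]
  push_cast
  ring

/-- The exponential sum of the Hermitian-type form `y ↦ Tr (c y ^ (q + 1))`. -/
noncomputable def hermSum (χ : AddChar F ℂ) (q : ℕ) (c : L) : ℂ :=
  ∑ y : L, traceChar L χ (c * y ^ (q + 1))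

theorem two_le_natCard (F L : Type*) [Field F] [Field L] [Finite L] [Algebra F L]
    (hF : Nat.card F = q) : 2 ≤ q := by
  have := finite_of_algebra F L
  exact hF ▸ Finite.one_lt_card

theorem succ_dvd_pow_two_mul_sub_one (q k : ℕ) : q + 1 ∣ q ^ (2 * k) - 1 := by
  rcases Nat.eq_zero_or_pos q with rfl | hq
  · simp
  have h1 : q ^ 2 - 1 ∣ q ^ (2 * k) - 1 := by
    rw [pow_mul]; simpa using Nat.sub_dvd_pow_sub_pow (q ^ 2) 1 k
  refine dvd_trans ⟨q - 1, ?_⟩ h1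
  simpa using Nat.sq_sub_sq q 1

theorem sq_sub_one_dvd_pow_two_mul_sub_one (q k : ℕ) : q ^ 2 - 1 ∣ q ^ (2 * k) - 1 := by
  rw [pow_mul]; simpa using Nat.sub_dvd_pow_sub_pow (q ^ 2) 1 k

/-- Every scalar of `F` is a `(q + 1)`-st power in `L`. -/
theorem exists_pow_succ_eq_algebraMap (hF : Nat.card F = q) (hL : Nat.card L = q ^ (2 * k))
    {u : F} (hu : u ≠ 0) : ∃ v : L, v ≠ 0 ∧ v ^ (q + 1) = algebraMap F L u := by
  have := finite_of_algebra F L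
  let := Fintype.ofFinite F
  obtain ⟨N, hN⟩ := sq_sub_one_dvd_pow_two_mul_sub_one q k
  have hM : Fintype.card L - 1 = (q + 1) * ((q - 1) * N) := by
    rw [← Nat.card_eq_fintype_card, hL, hN, ← mul_assoc]
    congr 1
    simpa using Nat.sq_sub_sq q 1
  -- The exponent complementary to `q + 1` is a multiple of `q - 1`, and `u ^ (q - 1) = 1`.
  refine exists_pow_eq_of_pow_eq_one hM ?_
  rw [Nat.card_eq_fintype_card] at hF
  rw [← map_pow, pow_mul, ← hF, FiniteField.pow_card_sub_one_eq_one u hu, one_pow, map_one]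

/-- The scalar is a `(q + 1)`-st power `v ^ (q + 1)`, absorbed by `y ↦ v * y`. The case `u = -1`
turns `g(c) g(-c)` into a square. -/
theorem hermSum_smul (hF : Nat.card F = q) (hL : Nat.card L = q ^ (2 * k)) (χ : AddChar F ℂ)
    {u : F} (hu : u ≠ 0) (c : L) : hermSum χ q (u • c) = hermSum χ q c := by
  obtain ⟨v, hv, hvu⟩ := exists_pow_succ_eq_algebraMap hF hL hu
  unfold hermSum
  refine Fintype.sum_bijective (fun y => v * y) (mulLeft_bijective₀ v hv) _ _ fun y => ?_
  rw [mul_pow, hvu, Algebra.smul_def]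
  congr 1
  ring

open scoped Classical in
theorem hermSum_eq_one_add (hL : Nat.card L = q ^ (2 * k)) (χ : AddChar F ℂ)
    {c : L} (hc : c ≠ 0) : hermSum χ q c = 1 + (q + 1) *
      ∑ z ∈ (Finset.univ.filter (fun y : L => y ≠ 0)).image (fun y => c * y ^ (q + 1)),
        traceChar L χ z := by
  unfold hermSum
  rw [sum_eq_apply_zero_add, sum_comp_mul_pow _ hc, nsmul_eq_mul]
  · simp
  · rw [← Nat.card_eq_fintype_card, hL]
    exact succ_dvd_pow_two_mul_sub_one q k

/-- The nonzero `y` cover the values `c * y ^ (q + 1)` with multiplicity `q + 1`, and the set of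
these values is stable under `Fˣ`, so its character sum is an integer. The resulting congruence mod
`q + 1` later determines the sign. -/
theorem exists_int_hermSum (hF : Nat.card F = q) (hL : Nat.card L = q ^ (2 * k))
    {χ : AddChar F ℂ} (hχ : χ ≠ 1) {c : L} (hc : c ≠ 0) :
    ∃ n : ℤ, hermSum χ q c = ((1 + (q + 1) * n : ℤ) : ℂ) := by
  classical
  obtain ⟨n, hn⟩ := exists_int_sum_traceChar hχ
    (A := (Finset.univ.filter (fun y : L => y ≠ 0)).image (fun y => c * y ^ (q + 1))) (by
      intro u hu a ha
      obtain ⟨v, hv, hvu⟩ := exists_pow_succ_eq_algebraMap (k := k) hF hL hu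
      obtain ⟨y, hy, rfl⟩ := Finset.mem_image.mp ha
      refine Finset.mem_image.mpr ⟨v * y, ?_, ?_⟩
      · simp only [Finset.mem_filter, Finset.mem_univ, true_and] at hy ⊢
        exact mul_ne_zero hv hy
      · rw [Algebra.smul_def, ← hvu, mul_pow]
        ring)
  refine ⟨n, ?_⟩
  rw [hermSum_eq_one_add hL χ hc, hn]
  push_cast
  rfl

open scoped Classical in
-- Substituting `y = w + z` cancels the `z ^ (q + 1)` terms, and Frobenius invariance of the trace
-- makes the rest additive in `z ^ q`. The sum over `z` then restricts `w` to the radical of the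
-- form, where `v = c * w ^ (q + 1)` satisfies `v ^ q = -v` and so has trace zero.
theorem hermSum_mul_hermSum_neg (hF : Nat.card F = q) (hL : Nat.card L = q ^ (2 * k))
    {χ : AddChar F ℂ} (hχ : χ ≠ 1) (c : L) :
    hermSum χ q c * hermSum χ q (-c) = (q : ℂ) ^ (2 * k) *
      (Finset.univ.filter fun w : L => c ^ q * w ^ q ^ 2 + c * w = 0).card := by
  have hfrob : ∀ x : L, traceChar L χ (x ^ q) = traceChar L χ x := fun x => by
    rw [traceChar_apply, traceChar_apply, trace_pow_natCard hF]
  unfold hermSum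
  have h1 : (∑ y : L, traceChar L χ (c * y ^ (q + 1))) * ∑ y : L, traceChar L χ (-c * y ^ (q + 1))
      = ∑ w : L, traceChar L χ (c * w ^ (q + 1)) *
        ∑ z : L, traceChar L χ ((c ^ q * w ^ q ^ 2 + c * w) * z ^ q) := by
    rw [Finset.sum_mul_sum, Finset.sum_comm]
    simp_rw [Finset.mul_sum]
    conv_rhs => rw [Finset.sum_comm]
    refine Finset.sum_congr rfl fun z _ => ?_
    refine (Fintype.sum_bijective (fun w => w + z) (AddGroup.addRight_bijective z) _ _ ?_).symm
    intro w
    have e : traceChar L χ (c ^ q * w ^ q ^ 2 * z ^ q) = traceChar L χ (c * w ^ q * z) := by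
      rw [← hfrob (c * w ^ q * z)]
      congr 1
      ring
    rw [add_mul, AddChar.map_add_eq_mul, e, ← AddChar.map_add_eq_mul, ← AddChar.map_add_eq_mul,
      ← AddChar.map_add_eq_mul]
    congr 1
    rw [pow_succ, pow_succ, pow_succ, add_pow_natCard hF]
    ring
  rw [h1]
  have h2 : ∀ w : L, traceChar L χ (c * w ^ (q + 1)) *
        ∑ z : L, traceChar L χ ((c ^ q * w ^ q ^ 2 + c * w) * z ^ q) =
      if c ^ q * w ^ q ^ 2 + c * w = 0 then (q : ℂ) ^ (2 * k) else 0 := by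
    intro w
    rw [Fintype.sum_bijective (fun z : L => z ^ q) (bijective_pow_natCard hF)
      (fun z => traceChar L χ ((c ^ q * w ^ q ^ 2 + c * w) * z ^ q))
      (fun z => traceChar L χ ((c ^ q * w ^ q ^ 2 + c * w) * z)) (fun _ => rfl),
      sum_traceChar_mul hχ]
    split_ifs with h
    · rw [traceChar_apply, trace_eq_zero_of_pow_eq_neg hF hL, AddChar.map_zero_eq_one, one_mul,
        ← Nat.card_eq_fintype_card, hL]
      · push_cast
        rfl
      · linear_combination w ^ q * h
    · rw [mul_zero]
  rw [Finset.sum_congr rfl fun w _ => h2 w, ← Finset.sum_filter, Finset.sum_const, nsmul_eq_mul,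
    mul_comm]

open scoped Classical in
-- The nonzero solutions form a fibre of `w ↦ w ^ (q ^ 2 - 1)`, which is empty or has `q ^ 2 - 1`
-- elements.
theorem card_radical (hq : 2 ≤ q) (hL : Nat.card L = q ^ (2 * k)) {c : L} (hc : c ≠ 0) :
    (Finset.univ.filter fun w : L => c ^ q * w ^ q ^ 2 + c * w = 0).card = 1 ∨
    (Finset.univ.filter fun w : L => c ^ q * w ^ q ^ 2 + c * w = 0).card = q ^ 2 := by
  have hq2 : q ^ 2 - 1 + 1 = q ^ 2 := Nat.sub_add_cancel (Nat.one_le_pow _ _ (by omega))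
  have hq0 : q ^ 2 ≠ 0 := pow_ne_zero _ (by omega)
  by_cases h : ∃ w : L, w ≠ 0 ∧ c ^ q * w ^ q ^ 2 + c * w = 0
  · right
    obtain ⟨w₀, hw₀, h⟩ := h
    have hd : q ^ 2 - 1 ∣ Fintype.card L - 1 := by
      rw [← Nat.card_eq_fintype_card, hL]
      exact sq_sub_one_dvd_pow_two_mul_sub_one q k
    have e : (Finset.univ.filter fun w : L => c ^ q * w ^ q ^ 2 + c * w = 0) =
        insert 0 (Finset.univ.filter fun w : L => w ^ (q ^ 2 - 1) = w₀ ^ (q ^ 2 - 1)) := by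
      ext w
      simp only [Finset.mem_filter, Finset.mem_univ, true_and, Finset.mem_insert]
      rw [← hq2, pow_succ, ← mul_assoc, ← add_mul] at h
      rw [← hq2, pow_succ, ← mul_assoc, ← add_mul, mul_eq_zero, or_comm, Nat.add_sub_cancel]
      have h0 := (mul_eq_zero.mp h).resolve_right hw₀
      refine or_congr_right ⟨fun h1 => ?_, fun h1 => by rw [h1, h0]⟩
      exact mul_left_cancel₀ (pow_ne_zero q hc) (by linear_combination h1 - h0)
    rw [e, Finset.card_insert_of_notMem, card_filter_pow_eq_pow hd hw₀, hq2]
    simp only [Finset.mem_filter, Finset.mem_univ, true_and]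
    rw [zero_pow (by have := Nat.pow_le_pow_left hq 2; omega)]
    exact (pow_ne_zero _ hw₀).symm
  · left
    push Not at h
    rw [Finset.card_eq_one]
    refine ⟨0, ?_⟩
    ext w
    simp only [Finset.mem_filter, Finset.mem_univ, true_and, Finset.mem_singleton]
    constructor
    · intro hw
      by_contra h0
      exact h w h0 hw
    · rintro rfl
      rw [zero_pow hq0, mul_zero, mul_zero, add_zero]

theorem dvd_pow_sub_neg_one_pow (q k : ℕ) : ((q : ℤ) + 1) ∣ (q : ℤ) ^ k - (-1) ^ k := by
  simpa using sub_dvd_pow_sub_pow (q : ℤ) (-1) k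

/-- The two possible values of the exponential sum. -/
theorem hermSum_eq_or (hF : Nat.card F = q) (hL : Nat.card L = q ^ (2 * k))
    {χ : AddChar F ℂ} (hχ : χ ≠ 1) {c : L} (hc : c ≠ 0) :
    hermSum χ q c = (-1) ^ k * (q : ℂ) ^ k ∨ hermSum χ q c = -((-1) ^ k * (q : ℂ) ^ (k + 1)) := by
  classical
  have hq := two_le_natCard F L hF
  obtain ⟨n, hn⟩ := exists_int_hermSum hF hL hχ hc
  have hsq := hermSum_mul_hermSum_neg hF hL hχ c
  rw [← neg_one_smul F c, hermSum_smul hF hL χ (neg_ne_zero.mpr one_ne_zero)] at hsq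
  set g : ℤ := 1 + (q + 1) * n with hg
  -- Both `g` and `(-1) ^ j * q ^ j` are 1 mod `q + 1`. The opposite sign would give `q + 1 ∣ 2`,
  -- impossible as `q ≥ 2`.
  have key : ∀ j : ℕ, g * g = ((q : ℤ) ^ j) * (q : ℤ) ^ j →
      g = (-1) ^ j * (q : ℤ) ^ j := by
    intro j hj
    obtain ⟨r, hr⟩ := dvd_pow_sub_neg_one_pow q j
    have hε : ((-1 : ℤ) ^ j) * (-1) ^ j = 1 := by rw [← mul_pow]; simp
    rcases neg_one_pow_eq_or ℤ j with he | he <;> rw [he] at hr ⊢ <;>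
      rcases mul_self_eq_mul_self_iff.mp hj with h | h
    · rw [h, one_mul]
    · exfalso
      have : ((q : ℤ) + 1) ∣ 2 := ⟨-n - r, by linear_combination h - hg - hr⟩
      have := Int.le_of_dvd (by norm_num) this
      omega
    · exfalso
      have : ((q : ℤ) + 1) ∣ 2 := ⟨r - n, by linear_combination hr - hg + h⟩
      have := Int.le_of_dvd (by norm_num) this
      omega
    · rw [h]; ring
  rw [hn] at hsq ⊢
  rcases card_radical hq hL hc with h | h <;> rw [h] at hsq
  · left
    rw [key k]
    · push_cast; rfl
    · have : ((g * g : ℤ) : ℂ) = (((q : ℤ) ^ k * (q : ℤ) ^ k : ℤ) : ℂ) := by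
        push_cast
        linear_combination hsq
      exact_mod_cast this
  · right
    rw [key (k + 1)]
    · push_cast; ring
    · have : ((g * g : ℤ) : ℂ) = (((q : ℤ) ^ (k + 1) * (q : ℤ) ^ (k + 1) : ℤ) : ℂ) := by
        push_cast at hsq ⊢
        linear_combination hsq
      exact_mod_cast this

theorem sum_hermSum {χ : AddChar F ℂ} (hχ : χ ≠ 1) :
    ∑ c : L, hermSum χ q c = Fintype.card L := by
  classical
  unfold hermSum
  rw [Finset.sum_comm]
  simp_rw [mul_comm _ (_ ^ (q + 1))]
  rw [Finset.sum_congr rfl fun y _ => sum_traceChar_mul hχ (y ^ (q + 1))]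
  simp

theorem hermSum_zero (χ : AddChar F ℂ) : hermSum χ q (0 : L) = Fintype.card L := by
  simp [hermSum]

/-- Both values of the exponential sum occur. -/
theorem exists_hermSum_eq (hF : Nat.card F = q) (hL : Nat.card L = q ^ (2 * k))
    {χ : AddChar F ℂ} (hχ : χ ≠ 1) :
    (∃ c : L, c ≠ 0 ∧ hermSum χ q c = (-1) ^ k * (q : ℂ) ^ k) ∧
      ∃ c : L, c ≠ 0 ∧ hermSum χ q c = -((-1) ^ k * (q : ℂ) ^ (k + 1)) := by
  classical
  have hq := two_le_natCard F L hF
  have h0 : ∑ c ∈ Finset.univ.erase (0 : L), hermSum χ q c = 0 := by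
    have h := sum_hermSum (q := q) (L := L) hχ
    rw [← Finset.add_sum_erase _ _ (Finset.mem_univ (0 : L)), hermSum_zero] at h
    linear_combination h
  have hcard : ((Finset.univ.erase (0 : L)).card : ℂ) ≠ 0 := by
    rw [Nat.cast_ne_zero, ← Nat.pos_iff_ne_zero, Finset.card_pos]
    exact ⟨1, by simp⟩
  have hqC : (q : ℂ) ≠ 0 := by
    rw [Nat.cast_ne_zero]; omega
  -- By `h0` the sums over `c ≠ 0` total zero, so they cannot all equal the same nonzero value `b`.
  have main : ∀ a b : ℂ, b ≠ 0 → (∀ c : L, c ≠ 0 → hermSum χ q c = a ∨ hermSum χ q c = b) →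
      ∃ c : L, c ≠ 0 ∧ hermSum χ q c = a := by
    intro a b hb hab
    by_contra! hne
    rw [Finset.sum_congr rfl fun c hc => (hab c (Finset.ne_of_mem_erase hc)).resolve_left
      (hne c (Finset.ne_of_mem_erase hc)), Finset.sum_const, nsmul_eq_mul] at h0
    exact (mul_ne_zero hcard hb) h0
  have hs : ((-1 : ℂ) ^ k) ≠ 0 := pow_ne_zero _ (by norm_num)
  exact ⟨main _ _ (neg_ne_zero.mpr (mul_ne_zero hs (pow_ne_zero _ hqC)))
      fun c hc => hermSum_eq_or hF hL hχ hc,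
    main _ _ (mul_ne_zero hs (pow_ne_zero _ hqC)) fun c hc => (hermSum_eq_or hF hL hχ hc).symm⟩

end CharacterSums

/-! ### Support and zeros of `Tr ∘ N` -/

section TraceNormSupport

variable {F E L : Type*} [Field F] [Field E] [Field L] [Fintype L]
  [Algebra F E] [Algebra E L] {q k : ℕ}

open scoped Classical in
/-- The elements of `L` at which `Tr ∘ N` does not vanish. -/
noncomputable def traceNormSupport (F E L : Type*) [Field F] [Field E] [Field L] [Fintype L]
    [Algebra F E] [Algebra E L] : Finset L :=
  Finset.univ.filter fun x => Algebra.trace F E (Algebra.norm E x) ≠ 0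

open scoped Classical in
/-- The nonzero elements of `L` at which `Tr ∘ N` vanishes. -/
noncomputable def traceNormZeros (F E L : Type*) [Field F] [Field E] [Field L] [Fintype L]
    [Algebra F E] [Algebra E L] : Finset L :=
  Finset.univ.filter fun x => x ≠ 0 ∧ Algebra.trace F E (Algebra.norm E x) = 0

theorem mem_traceNormSupport {x : L} :
    x ∈ traceNormSupport F E L ↔ Algebra.trace F E (Algebra.norm E x) ≠ 0 := by
  simp [traceNormSupport]

theorem mem_traceNormZeros {x : L} :
    x ∈ traceNormZeros F E L ↔ x ≠ 0 ∧ Algebra.trace F E (Algebra.norm E x) = 0 := by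
  simp [traceNormZeros]

theorem mem_definingSet {a : F} {x : L} :
    x ∈ definingSet F E L a ↔ x ≠ 0 ∧ Algebra.trace F E (Algebra.norm E x) + a = 0 := by
  simp [definingSet]

theorem finrank_top_eq (hE : Nat.card E = q ^ 2) (hL : Nat.card L = q ^ (2 * k)) :
    Module.finrank E L = k :=
  finrank_eq_of_natCard hE (by rw [hL, pow_mul])

theorem zero_notMem_traceNormSupport : (0 : L) ∉ traceNormSupport F E L := by
  have := finite_of_algebra E L
  rw [mem_traceNormSupport, Algebra.norm_zero, map_zero, not_not]

theorem traceNormZeros_nonempty (hF : Nat.card F = q) (hE : Nat.card E = q ^ 2) :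
    (traceNormZeros F E L).Nonempty := by
  have := finite_of_algebra E L
  have := finite_of_algebra F E
  let := Fintype.ofFinite E
  have h : LinearMap.ker (Algebra.trace F E) ≠ ⊥ := by
    apply LinearMap.ker_ne_bot_of_finrank_lt
    rw [finrank_eq_of_natCard hF hE, Module.finrank_self]
    norm_num
  obtain ⟨β, hβ, hβ0⟩ := Submodule.exists_mem_ne_zero_of_ne_bot h
  obtain ⟨z, rfl⟩ := FiniteField.norm_surjective E L β
  refine ⟨z, mem_traceNormZeros.mpr ⟨?_, hβ⟩⟩
  rintro rfl
  exact hβ0 Algebra.norm_zero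

/-- Here `N(z)` is `z ^ N`, and `β + β ^ q = 0` with `β ≠ 0` means `β ^ (q - 1) = -1`. -/
theorem pow_eq_neg_one_of_mem_traceNormZeros (hF : Nat.card F = q) (hE : Nat.card E = q ^ 2)
    {N : ℕ} (hN : Fintype.card L - 1 = (q ^ 2 - 1) * N) {z : L} (hz : z ∈ traceNormZeros F E L) :
    z ^ ((q - 1) * N) = -1 := by
  have := finite_of_algebra E L
  let := Fintype.ofFinite E
  have hq := two_le_natCard F E hF
  have hq2 : 0 < q ^ 2 - 1 := by
    have := Nat.pow_le_pow_left hq 2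
    omega
  obtain ⟨hz0, hz⟩ := mem_traceNormZeros.mp hz
  have h := FiniteField.algebraMap_trace_eq_sum_pow F E (Algebra.norm E z)
  rw [hz, finrank_eq_of_natCard hF hE, hF, map_zero] at h
  have h2 := congrArg (algebraMap E L) h
  simp only [Finset.sum_range_succ, Finset.sum_range_zero, map_add, map_pow, map_zero,
    FiniteField.algebraMap_norm_eq_pow, pow_zero, pow_one, zero_add] at h2
  rw [Nat.card_eq_fintype_card (α := L), hN, hE, Nat.mul_div_cancel_left _ hq2, ← pow_mul] at h2
  have hNq : N * q = (q - 1) * N + N := by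
    obtain ⟨r, rfl⟩ := Nat.exists_eq_add_of_le hq
    rw [show 2 + r - 1 = r + 1 by omega]
    ring
  rw [hNq, pow_add] at h2
  exact mul_right_cancel₀ (pow_ne_zero N hz0) (by linear_combination -h2)

theorem sum_eq_support_add_zeros {M : Type*} [AddCommMonoid M] (f : L → M) :
    ∑ x, f x = f 0 + (∑ x ∈ traceNormSupport F E L, f x + ∑ x ∈ traceNormZeros F E L, f x) := by
  classical
  have := finite_of_algebra E L
  rw [sum_eq_apply_zero_add, ← Finset.sum_filter_add_sum_filter_not (Finset.univ.filter _)
    (fun x : L => Algebra.trace F E (Algebra.norm E x) ≠ 0)]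
  congr 3
  · ext x
    simp only [mem_traceNormSupport, Finset.mem_filter, Finset.mem_univ, true_and,
      and_iff_right_iff_imp]
    rintro h rfl
    exact h (by rw [Algebra.norm_zero, map_zero])
  · ext x
    simp [mem_traceNormZeros]

theorem definingSet_trace_norm {x : L} (hx : x ∈ definingSet F E L 1) :
    Algebra.trace F E (Algebra.norm E x) = -1 :=
  eq_neg_of_add_eq_zero_left (mem_definingSet.mp hx).2

open scoped Classical in
/-- The zeros of `Tr ∘ N` form one coset of the group of `(q + 1)`-st powers. -/
theorem traceNormZeros_eq_image (hF : Nat.card F = q) (hE : Nat.card E = q ^ 2)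
    (hL : Nat.card L = q ^ (2 * k)) {z₀ : L} (hz₀ : z₀ ∈ traceNormZeros F E L) :
    traceNormZeros F E L =
      (Finset.univ.filter (fun y : L => y ≠ 0)).image (fun y => z₀ * y ^ (q + 1)) := by
  have := finite_of_algebra E L
  let := Fintype.ofFinite E
  have hz := mem_traceNormZeros.mp hz₀
  obtain ⟨N, hN⟩ := sq_sub_one_dvd_pow_two_mul_sub_one q k
  rw [← hL, Nat.card_eq_fintype_card] at hN
  have hM : Fintype.card L - 1 = (q + 1) * ((q - 1) * N) := by
    rw [hN, ← mul_assoc]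
    congr 1
    simpa using Nat.sq_sub_sq q 1
  ext z
  simp only [Finset.mem_image, Finset.mem_filter, Finset.mem_univ, true_and]
  constructor
  · intro h
    -- The quotient of two zeros is killed by the exponent `(q - 1) * N`, hence is a `(q + 1)`-st
    -- power.
    obtain ⟨y, hy, hyz⟩ := exists_pow_eq_of_pow_eq_one (x := z / z₀) hM (by
      rw [div_pow, pow_eq_neg_one_of_mem_traceNormZeros hF hE hN h,
        pow_eq_neg_one_of_mem_traceNormZeros hF hE hN hz₀, div_self (neg_ne_zero.mpr one_ne_zero)])
    exact ⟨y, hy, by rw [hyz, mul_div_cancel₀ _ hz.1]⟩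
  · rintro ⟨y, hy, rfl⟩
    refine mem_traceNormZeros.mpr ⟨mul_ne_zero hz.1 (pow_ne_zero _ hy), ?_⟩
    -- For `β` in `E`, `β ^ (q + 1)` is its norm to `F`, a scalar that leaves the trace by
    -- linearity.
    have h := FiniteField.algebraMap_norm_eq_pow_sum F E (Algebra.norm E y)
    rw [finrank_eq_of_natCard hF hE, hF] at h
    simp only [Finset.sum_range_succ, Finset.sum_range_zero, pow_zero, pow_one, zero_add] at h
    rw [map_mul, map_pow, add_comm q 1, ← h, mul_comm, ← Algebra.smul_def, map_smul, hz.2,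
      smul_zero]

open scoped Classical in
theorem sum_traceNormZeros {M : Type*} [AddCommMonoid M] (hF : Nat.card F = q)
    (hE : Nat.card E = q ^ 2) (hL : Nat.card L = q ^ (2 * k)) {z₀ : L}
    (hz₀ : z₀ ∈ traceNormZeros F E L) (f : L → M) :
    ∑ y ∈ Finset.univ.filter (fun y : L => y ≠ 0), f (z₀ * y ^ (q + 1)) =
      (q + 1) • ∑ z ∈ traceNormZeros F E L, f z := by
  rw [traceNormZeros_eq_image hF hE hL hz₀, ← sum_comp_mul_pow _ (mem_traceNormZeros.mp hz₀).1]
  rw [← Nat.card_eq_fintype_card, hL]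
  exact succ_dvd_pow_two_mul_sub_one q k

theorem card_traceNormSupport (hF : Nat.card F = q) (hE : Nat.card E = q ^ 2)
    (hL : Nat.card L = q ^ (2 * k)) :
    ((traceNormSupport F E L).card : ℚ) = q * ((q : ℚ) ^ (2 * k) - 1) / (q + 1) := by
  classical
  obtain ⟨z₀, hz₀⟩ := traceNormZeros_nonempty (L := L) hF hE
  have h1 := sum_traceNormZeros hF hE hL hz₀ (fun _ => (1 : ℚ))
  have h2 := sum_eq_support_add_zeros (F := F) (E := E) (L := L) (fun _ => (1 : ℚ))
  have h3 := sum_eq_apply_zero_add (fun _ : L => (1 : ℚ))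
  simp only [Finset.sum_const, nsmul_eq_mul, mul_one, Finset.card_univ,
    ← Nat.card_eq_fintype_card, hL, Nat.cast_pow, Nat.cast_add, Nat.cast_one] at h1 h2 h3
  rw [eq_div_iff (by positivity)]
  linear_combination -(q + 1) * h2 + h3 + h1

theorem definingSet_subset_support : definingSet F E L 1 ⊆ traceNormSupport F E L := by
  intro x hx
  rw [mem_traceNormSupport, definingSet_trace_norm hx]
  exact neg_ne_zero.mpr one_ne_zero

variable [Algebra F L]

/-- The Fourier coefficients of the support of `Tr ∘ N`. -/
theorem sum_traceChar_support (hF : Nat.card F = q) (hE : Nat.card E = q ^ 2)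
    (hL : Nat.card L = q ^ (2 * k)) {χ : AddChar F ℂ} (hχ : χ ≠ 1) {z₀ : L}
    (hz₀ : z₀ ∈ traceNormZeros F E L) {b : L} (hb : b ≠ 0) :
    (q + 1) * ∑ s ∈ traceNormSupport F E L, traceChar L χ (b * s) =
      -(q + hermSum χ q (b * z₀)) := by
  classical
  -- The character sum over all of `L` vanishes, so the sum over the support is minus 1 minus the
  -- sum over the zeros, which `hermSum` computes.
  have h1 := sum_traceNormZeros hF hE hL hz₀ (fun x => traceChar L χ (b * x))
  have h2 := sum_eq_support_add_zeros (F := F) (E := E) (L := L) (fun x => traceChar L χ (b * x))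
  rw [sum_traceChar_mul hχ, if_neg hb, mul_zero, AddChar.map_zero_eq_one] at h2
  have h3 := sum_eq_apply_zero_add (fun y : L => traceChar L χ (b * z₀ * y ^ (q + 1)))
  simp only [zero_pow (Nat.succ_ne_zero q), mul_zero, AddChar.map_zero_eq_one, mul_assoc b] at h3
  unfold hermSum
  simp only [mul_assoc b]
  rw [nsmul_eq_mul] at h1
  push_cast at h1
  linear_combination -(q + 1) * h2 + h3 + h1

variable [IsScalarTower F E L]

theorem trace_norm_smul (hE : Nat.card E = q ^ 2) (hL : Nat.card L = q ^ (2 * k)) (u : F) (x : L) :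
    Algebra.trace F E (Algebra.norm E (u • x)) = u ^ k * Algebra.trace F E (Algebra.norm E x) := by
  rw [Algebra.smul_def, IsScalarTower.algebraMap_apply F E L, map_mul, Algebra.norm_algebraMap,
    finrank_top_eq hE hL, ← map_pow, ← Algebra.smul_def, map_smul, smul_eq_mul]

theorem smul_mem_traceNormSupport (hE : Nat.card E = q ^ 2) (hL : Nat.card L = q ^ (2 * k))
    {u : F} (hu : u ≠ 0) {x : L} (hx : x ∈ traceNormSupport F E L) :
    u • x ∈ traceNormSupport F E L := by
  rw [mem_traceNormSupport] at hx ⊢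
  rw [trace_norm_smul hE hL]
  exact mul_ne_zero (pow_ne_zero _ hu) hx

end TraceNormSupport

/-! ### The defining set represents the `F`-lines of the support -/

section DefiningSet

variable {F E L : Type*} [Field F] [Field E] [Field L] [Fintype L]
  [Algebra F E] [Algebra F L] [Algebra E L] [IsScalarTower F E L] {q k : ℕ}

theorem pow_injective_of_gcd (hF : Nat.card F = q) (hq : 2 ≤ q) (hk : 0 < k)
    (hgcd : Nat.gcd k (q - 1) = 1) : Function.Injective fun u : F => u ^ k := by
  have : Finite F := Nat.finite_of_card_ne_zero (by omega)
  let := Fintype.ofFinite F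
  intro u v huv
  simp only at huv
  rcases eq_or_ne v 0 with rfl | hv
  · rw [zero_pow hk.ne'] at huv
    exact pow_eq_zero_iff hk.ne' |>.mp huv
  · have h1 : (u / v) ^ k = 1 := by rw [div_pow, huv, div_self (pow_ne_zero _ hv)]
    have h0 : u / v ≠ 0 := by
      intro h
      rw [h, zero_pow hk.ne'] at h1
      exact zero_ne_one h1
    have h2 : (u / v) ^ (q - 1) = 1 := by
      rw [← hF, Nat.card_eq_fintype_card]
      exact FiniteField.pow_card_sub_one_eq_one _ h0
    have h3 := pow_gcd_eq_one.mpr ⟨h1, h2⟩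
    rw [hgcd, pow_one] at h3
    exact (div_eq_one_iff_eq hv).mp h3

/-- Two elements of the defining set on the same `F`-line coincide. -/
theorem eq_of_smul_eq_smul (hF : Nat.card F = q) (hE : Nat.card E = q ^ 2)
    (hL : Nat.card L = q ^ (2 * k)) (hk : 0 < k) (hgcd : Nat.gcd k (q - 1) = 1) {u v : F}
    (hu : u ≠ 0) {x y : L} (hx : x ∈ definingSet F E L 1) (hy : y ∈ definingSet F E L 1)
    (h : u • x = v • y) : u = v ∧ x = y := by
  have h1 := congrArg (fun t => Algebra.trace F E (Algebra.norm E t)) h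
  simp only [trace_norm_smul hE hL, definingSet_trace_norm hx, definingSet_trace_norm hy,
    mul_neg_one, neg_inj] at h1
  obtain rfl := pow_injective_of_gcd hF (two_le_natCard F L hF) hk hgcd h1
  exact ⟨rfl, smul_right_injective L hu h⟩

/-- An injective power map on a finite field is surjective, so some `u` has `u ^ k = -Tr(N(x))`;
dividing `x` by `u` normalizes `Tr ∘ N` to `-1`. -/
theorem exists_smul_of_mem_support (hF : Nat.card F = q) (hE : Nat.card E = q ^ 2)
    (hL : Nat.card L = q ^ (2 * k)) (hk : 0 < k) (hgcd : Nat.gcd k (q - 1) = 1) {x : L}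
    (hx : x ∈ traceNormSupport F E L) :
    ∃ u : F, u ≠ 0 ∧ ∃ d ∈ definingSet F E L 1, x = u • d := by
  have := finite_of_algebra F L
  rw [mem_traceNormSupport] at hx
  obtain ⟨u, hu⟩ := Finite.injective_iff_surjective.mp
    (pow_injective_of_gcd hF (two_le_natCard F L hF) hk hgcd)
    (-Algebra.trace F E (Algebra.norm E x))
  simp only at hu
  have hu0 : u ≠ 0 := by
    rintro rfl
    rw [zero_pow hk.ne', eq_comm, neg_eq_zero] at hu
    exact hx hu
  refine ⟨u, hu0, u⁻¹ • x, mem_definingSet.mpr ⟨?_, ?_⟩, (smul_inv_smul₀ hu0 x).symm⟩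
  · refine smul_ne_zero (inv_ne_zero hu0) ?_
    rintro rfl
    exact zero_notMem_traceNormSupport (mem_traceNormSupport.mpr hx)
  · rw [trace_norm_smul hE hL, inv_pow, hu, inv_neg, neg_mul, inv_mul_cancel₀ hx, neg_add_cancel]

theorem sum_support_eq {M : Type*} [AddCommMonoid M] (hF : Nat.card F = q)
    (hE : Nat.card E = q ^ 2) (hL : Nat.card L = q ^ (2 * k)) (hk : 0 < k)
    (hgcd : Nat.gcd k (q - 1) = 1) [Fintype F] [DecidableEq F] (f : L → M) :
    ∑ s ∈ traceNormSupport F E L, f s =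
      ∑ d ∈ definingSet F E L 1, ∑ u ∈ Finset.univ.filter (fun u : F => u ≠ 0), f (u • d) := by
  rw [← Finset.sum_product']
  symm
  refine Finset.sum_nbij (fun p => p.2 • p.1) ?_ ?_ ?_ (fun _ _ => rfl)
  · rintro ⟨d, u⟩ h
    simp only [Finset.mem_product, Finset.mem_filter, Finset.mem_univ, true_and] at h
    exact smul_mem_traceNormSupport hE hL h.2 (definingSet_subset_support h.1)
  · rintro ⟨d, u⟩ h ⟨d', u'⟩ h' heq
    simp only [Finset.coe_product, Set.mem_prod, Finset.mem_coe, Finset.mem_filter,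
      Finset.mem_univ, true_and] at h h'
    obtain ⟨rfl, rfl⟩ := eq_of_smul_eq_smul hF hE hL hk hgcd h.2 h.1 h'.1 heq
    rfl
  · intro x hx
    obtain ⟨u, hu, d, hd, rfl⟩ := exists_smul_of_mem_support hF hE hL hk hgcd hx
    exact ⟨(d, u), by simp [hd, hu], rfl⟩

end DefiningSet

/-! ### Strongly regular Cayley graphs from two Fourier coefficients -/

section Cayley

open scoped Classical in
/-- Counting representations as sums of two elements of a set with two nontrivial Fourier
coefficients. -/
theorem card_filter_sub_mem_of_fourier {L : Type*} [Field L] [Fintype L] {ψ : AddChar L ℂ}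
    (hψ : ψ.IsPrimitive) (S : Finset L) {θ₁ θ₂ : ℂ}
    (hS : ∀ b : L, b ≠ 0 → ∑ s ∈ S, ψ (b * s) = θ₁ ∨ ∑ s ∈ S, ψ (b * s) = θ₂) (t : L) :
    (Fintype.card L : ℂ) * ((S.filter fun s => t - s ∈ S).card
      - (θ₁ + θ₂) * (if t ∈ S then 1 else 0) + θ₁ * θ₂ * (if t = 0 then 1 else 0)) =
      (S.card - θ₁) * (S.card - θ₂) := by
  have orth : ∀ a : L, ∑ b : L, ψ (b * a) = if a = 0 then (Fintype.card L : ℂ) else 0 := by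
    intro a
    rw [AddChar.sum_mulShift a hψ]
    split_ifs <;> simp
  have h2 : ∑ b : L, ψ (b * -t) * ((∑ s ∈ S, ψ (b * s)) * ∑ s ∈ S, ψ (b * s)) =
      Fintype.card L * (S.filter fun s => t - s ∈ S).card := by
    have e : ∀ b : L, ψ (b * -t) * ((∑ s ∈ S, ψ (b * s)) * ∑ s ∈ S, ψ (b * s)) =
        ∑ s ∈ S, ∑ r ∈ S, ψ (b * (s + r - t)) := by
      intro b
      rw [Finset.sum_mul_sum, Finset.mul_sum]
      refine Finset.sum_congr rfl fun s _ => ?_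
      rw [Finset.mul_sum]
      refine Finset.sum_congr rfl fun r _ => ?_
      rw [← AddChar.map_add_eq_mul, ← AddChar.map_add_eq_mul]
      congr 1
      ring
    simp_rw [e]
    rw [Finset.sum_comm, Finset.card_filter, Nat.cast_sum, Finset.mul_sum]
    refine Finset.sum_congr rfl fun s _ => ?_
    rw [Finset.sum_comm]
    simp_rw [orth]
    have : ∀ r : L, s + r - t = 0 ↔ r = t - s := fun r => by
      constructor <;> intro h <;> linear_combination h
    simp_rw [this, Finset.sum_ite_eq']
    split_ifs <;> simp
  have h1 : ∑ b : L, ψ (b * -t) * ∑ s ∈ S, ψ (b * s) =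
      Fintype.card L * (if t ∈ S then 1 else 0) := by
    have e : ∀ b : L, ψ (b * -t) * ∑ s ∈ S, ψ (b * s) = ∑ s ∈ S, ψ (b * (s - t)) := by
      intro b
      rw [Finset.mul_sum]
      refine Finset.sum_congr rfl fun s _ => ?_
      rw [← AddChar.map_add_eq_mul]
      congr 1
      ring
    simp_rw [e]
    rw [Finset.sum_comm]
    simp_rw [orth, sub_eq_zero, Finset.sum_ite_eq']
    split_ifs <;> simp
  have h0 : ∑ b : L, ψ (b * -t) = Fintype.card L * (if t = 0 then 1 else 0) := by
    rw [orth, neg_eq_zero]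
    split_ifs <;> simp
  -- The quadratic in the Fourier coefficient vanishes at every `b ≠ 0`, so only the trivial
  -- character contributes. Expanding the quadratic and inverting gives the count.
  have key : ∑ b : L, ψ (b * -t) * ((∑ s ∈ S, ψ (b * s) - θ₁) * (∑ s ∈ S, ψ (b * s) - θ₂)) =
      (S.card - θ₁) * (S.card - θ₂) := by
    rw [Finset.sum_eq_single_of_mem 0 (Finset.mem_univ 0)]
    · simp
    · intro b _ hb
      rcases hS b hb with h | h <;> rw [h] <;> ring
  rw [← key, mul_add, mul_sub, ← h2, mul_left_comm, ← h1, mul_left_comm, ← h0, Finset.mul_sum,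
    Finset.mul_sum, ← Finset.sum_sub_distrib, ← Finset.sum_add_distrib]
  refine Finset.sum_congr rfl fun b _ => ?_
  ring

open scoped Classical in
/-- A Cayley graph on an abelian group is strongly regular as soon as the numbers of
representations of group elements as sums of two connectors take the right values. -/
theorem isStronglyRegular_of_equiv {V A : Type*} [AddCommGroup A] [Fintype A]
    (G : SimpleGraph V) (e : V ≃ A) (S : Finset A)
    (hadj : ∀ v w, G.Adj v w ↔ e v - e w ∈ S) (hneg : ∀ s ∈ S, -s ∈ S) {K lam mu : ℕ}
    (hK : S.card = K) (hlam : ∀ t ∈ S, (S.filter fun s => t - s ∈ S).card = lam)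
    (hmu : ∀ t, t ≠ 0 → t ∉ S → (S.filter fun s => t - s ∈ S).card = mu) (hmu0 : 0 < mu) :
    IsStronglyRegular G (Fintype.card A) K lam mu := by
  let : Fintype V := Fintype.ofEquiv A e.symm
  have hcommon : ∀ v w, Fintype.card (G.commonNeighbors v w) =
      (S.filter fun s => (e v - e w) - s ∈ S).card := by
    intro v w
    rw [← Fintype.card_coe]
    refine Fintype.card_congr (Equiv.subtypeEquiv (e.trans (Equiv.subLeft (e v))) fun x => ?_)
    rw [SimpleGraph.mem_commonNeighbors, hadj, hadj, Finset.mem_filter]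
    simp only [Equiv.trans_apply, Equiv.subLeft_apply]
    refine and_congr_right fun _ => ?_
    have : e v - e w - (e v - e x) = -(e w - e x) := by abel
    rw [this]
    exact ⟨hneg _, fun h => by simpa using hneg _ h⟩
  refine ⟨?_, inferInstance, inferInstance, inferInstance, ?_, ?_, ?_, ?_⟩
  · have : Nonempty V := ⟨e.symm 0⟩
    refine ⟨fun v w => ?_⟩
    by_cases h : G.Adj v w
    · exact h.reachable
    by_cases hvw : v = w
    · rw [hvw]
    -- Since `mu > 0`, distinct nonadjacent vertices are joined by a path of length two.
    have h0 : 0 < Fintype.card (G.commonNeighbors v w) := by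
      rw [hcommon, hmu _ (sub_ne_zero.mpr fun h => hvw (e.injective h)) (mt (hadj v w).mpr h)]
      exact hmu0
    obtain ⟨x, hx⟩ := Fintype.card_pos_iff.mp h0
    rw [SimpleGraph.mem_commonNeighbors] at hx
    exact hx.1.reachable.trans hx.2.symm.reachable
  · exact Fintype.card_congr e
  · intro v
    rw [← SimpleGraph.card_neighborSet_eq_degree, ← hK, ← Fintype.card_coe]
    refine Fintype.card_congr (Equiv.subtypeEquiv (e.trans (Equiv.subLeft (e v))) fun x => ?_)
    rw [SimpleGraph.mem_neighborSet, hadj]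
    rfl
  · intro v w h
    rw [hcommon, hlam _ ((hadj v w).mp h)]
  · intro v w hvw h
    rw [hcommon, hmu _ (sub_ne_zero.mpr fun h => hvw (e.injective h)) (mt (hadj v w).mpr h)]

end Cayley

/-! ### The graph parameters -/

section Parameters

variable {F E L : Type*} [Field F] [Field E] [Field L] [Fintype L]
  [Algebra F E] [Algebra F L] [Algebra E L] {q k : ℕ}

theorem sum_traceChar_support_eq_or (hF : Nat.card F = q) (hE : Nat.card E = q ^ 2)
    (hL : Nat.card L = q ^ (2 * k)) {χ : AddChar F ℂ} (hχ : χ ≠ 1) {b : L} (hb : b ≠ 0) :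
    ∑ s ∈ traceNormSupport F E L, traceChar L χ (b * s) =
        ((-(q + (-1) ^ k * q ^ k) / (q + 1) : ℚ) : ℂ) ∨
      ∑ s ∈ traceNormSupport F E L, traceChar L χ (b * s) =
        ((-(q - (-1) ^ k * q ^ (k + 1)) / (q + 1) : ℚ) : ℂ) := by
  obtain ⟨z₀, hz₀⟩ := traceNormZeros_nonempty (L := L) hF hE
  have h := sum_traceChar_support hF hE hL hχ hz₀ hb
  have hq : (q : ℂ) + 1 ≠ 0 := by exact_mod_cast Nat.succ_ne_zero q
  rcases hermSum_eq_or hF hL hχ (mul_ne_zero hb (mem_traceNormZeros.mp hz₀).1) with hG | hG <;>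
    rw [hG] at h
  · left
    push_cast
    rw [eq_div_iff hq]
    linear_combination h
  · right
    push_cast
    rw [eq_div_iff hq]
    linear_combination h

open scoped Classical in
theorem card_filter_sub_mem_support (hF : Nat.card F = q) (hE : Nat.card E = q ^ 2)
    (hL : Nat.card L = q ^ (2 * k)) {t : L} (ht : t ≠ 0) :
    (((traceNormSupport F E L).filter fun s => t - s ∈ traceNormSupport F E L).card : ℚ) =
      (q : ℚ) * ((q : ℚ) ^ k - (-1) ^ k) * ((q : ℚ) ^ (k + 1) + (-1) ^ k) / ((q : ℚ) + 1) ^ 2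
      - (2 * q + (-1) ^ k * (q : ℚ) ^ k * (1 - q)) / (q + 1) *
        (if t ∈ traceNormSupport F E L then 1 else 0) := by
  have := finite_of_algebra F L
  have hq := two_le_natCard F L hF
  obtain ⟨χ, hχ⟩ := exists_addChar_ne_one F
  have h := card_filter_sub_mem_of_fourier (isPrimitive_traceChar hχ) (traceNormSupport F E L)
    (fun b hb => sum_traceChar_support_eq_or hF hE hL hχ hb) t
  rw [if_neg ht, mul_zero, add_zero, ← Nat.card_eq_fintype_card, hL] at h
  set n := ((traceNormSupport F E L).filter fun s => t - s ∈ traceNormSupport F E L).card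
  have h' : ((q ^ (2 * k) : ℕ) : ℚ) * (n - (-(q + (-1) ^ k * q ^ k) / (q + 1) +
      -(q - (-1) ^ k * q ^ (k + 1)) / (q + 1)) *
        (if t ∈ traceNormSupport F E L then 1 else 0)) =
      ((traceNormSupport F E L).card - -(q + (-1) ^ k * q ^ k) / (q + 1)) *
        ((traceNormSupport F E L).card - -(q - (-1) ^ k * q ^ (k + 1)) / (q + 1)) := by
    split_ifs at h ⊢ <;> exact_mod_cast h
  have hx : (q : ℚ) ^ k ≠ 0 := by positivity
  have ha : (q : ℚ) + 1 ≠ 0 := by positivity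
  rw [card_traceNormSupport hF hE hL, pow_succ] at h'
  rw [pow_succ (q : ℚ) k]
  push_cast at h'
  rw [mul_comm 2 k, pow_mul] at h'
  generalize (q : ℚ) ^ k = x at *
  generalize (-1 : ℚ) ^ k = ε at *
  generalize (if t ∈ traceNormSupport F E L then (1 : ℚ) else 0) = δ at *
  generalize (n : ℚ) = c at *
  generalize (q : ℚ) = r at *
  apply mul_left_cancel₀ (pow_ne_zero 2 hx)
  -- Both differences `|S| - θ` contain the factor `x = q ^ k`, so the product cancels the factor
  -- `|L| = x ^ 2`.
  have e1 : r * (x ^ 2 - 1) / (r + 1) - -(r + ε * x) / (r + 1) = x * (r * x + ε) / (r + 1) := by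
    rw [div_sub_div_same]
    congr 1
    ring
  have e2 : r * (x ^ 2 - 1) / (r + 1) - -(r - ε * (x * r)) / (r + 1) =
      r * x * (x - ε) / (r + 1) := by
    rw [div_sub_div_same]
    congr 1
    ring
  rw [e1, e2] at h'
  rw [div_eq_mul_inv _ ((r + 1) ^ 2), ← inv_pow]
  linear_combination h'

/-- The three graph parameters, together with the counting facts that define them. -/
theorem exists_parameters (hF : Nat.card F = q) (hE : Nat.card E = q ^ 2)
    (hL : Nat.card L = q ^ (2 * k)) (hk : 0 < k) [DecidableEq L] :
    ∃ K lam mu : ℕ,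
      (K : ℚ) = (q : ℚ) * ((q : ℚ) ^ (2 * k) - 1) / ((q : ℚ) + 1) ∧
      (lam : ℚ) = ((q : ℚ) ^ (2 * k + 2) - 2 * (q : ℚ) ^ 2 - 3 * (q : ℚ)
          - (-1) ^ k * (q : ℚ) ^ k * (1 - (q : ℚ))) / ((q : ℚ) + 1) ^ 2 ∧
      (mu : ℚ) = (q : ℚ) * ((q : ℚ) ^ k - (-1) ^ k)
          * ((q : ℚ) ^ (k + 1) + (-1) ^ k) / ((q : ℚ) + 1) ^ 2 ∧
      (traceNormSupport F E L).card = K ∧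
      (∀ t ∈ traceNormSupport F E L,
        ((traceNormSupport F E L).filter fun s => t - s ∈ traceNormSupport F E L).card = lam) ∧
      (∀ t, t ≠ 0 → t ∉ traceNormSupport F E L →
        ((traceNormSupport F E L).filter fun s => t - s ∈ traceNormSupport F E L).card = mu) ∧
      0 < mu := by
  have hq := two_le_natCard F L hF
  have hq' : (2 : ℚ) ≤ q := by exact_mod_cast hq
  have ha : (q : ℚ) + 1 ≠ 0 := by positivity
  have hx2 : (2 : ℚ) ≤ (q : ℚ) ^ k := hq'.trans (le_self_pow₀ (by linarith) hk.ne')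
  have hε : ((-1 : ℚ) ^ k) * (-1) ^ k = 1 := by rw [← mul_pow]; simp
  have hne : (0 : ℚ) < (traceNormSupport F E L).card := by
    rw [card_traceNormSupport hF hE hL, mul_comm 2 k, pow_mul]
    have : 0 < ((q : ℚ) ^ k) ^ 2 - 1 := by nlinarith
    positivity
  obtain ⟨s₀, hs₀⟩ := Finset.card_pos.mp (Nat.cast_pos.mp hne)
  obtain ⟨z₀, hz₀⟩ := traceNormZeros_nonempty (L := L) hF hE
  have hs₀0 : s₀ ≠ 0 := fun h => zero_notMem_traceNormSupport (h ▸ hs₀)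
  obtain ⟨hz₀0, hz₀⟩ := mem_traceNormZeros.mp hz₀
  have hz₀' : z₀ ∉ traceNormSupport F E L := fun h => mem_traceNormSupport.mp h hz₀
  have hcount : ∀ t : L, t ≠ 0 →
      (((traceNormSupport F E L).filter fun s => t - s ∈ traceNormSupport F E L).card : ℚ) = _ :=
    fun t ht => by
      convert card_filter_sub_mem_support hF hE hL ht
  have h1 := hcount s₀ hs₀0
  have h2 := hcount z₀ hz₀0
  rw [if_pos hs₀] at h1
  rw [if_neg hz₀', mul_zero, sub_zero] at h2
  -- Integrality needs no divisibility argument: `lam` and `mu` are the actual counts at one `s₀` in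
  -- the support and one nonzero `z₀` outside it.
  refine ⟨_, _, _, card_traceNormSupport hF hE hL, h1.trans ?_, h2, rfl, ?_, ?_, ?_⟩
  · rw [mul_comm 2 k, pow_add _ (k * 2) 2, pow_mul, pow_succ (q : ℚ) k]
    generalize (q : ℚ) ^ k = x at *
    generalize (-1 : ℚ) ^ k = ε at *
    generalize (q : ℚ) = r at *
    field_simp
    linear_combination (-r) * hε
  · intro t ht
    have ht0 : t ≠ 0 := fun h => zero_notMem_traceNormSupport (h ▸ ht)
    have h := hcount t ht0
    rw [if_pos ht, ← h1] at h
    exact_mod_cast h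
  · intro t ht0 ht
    have h := hcount t ht0
    rw [if_neg ht, mul_zero, sub_zero, ← h2] at h
    exact_mod_cast h
  · rw [← Nat.cast_pos (α := ℚ), h2, pow_succ]
    have hx3 : (2 : ℚ) ≤ (q : ℚ) ^ k * q := by nlinarith
    rcases neg_one_pow_eq_or ℚ k with h | h <;> rw [h]
    · have : 0 < (q : ℚ) ^ k - 1 := by linarith
      positivity
    · have : 0 < (q : ℚ) ^ k * q + -1 := by linarith
      have : 0 < (q : ℚ) ^ k - -1 := by linarith
      positivity

end Parameters

/-! ### The code: dimension, weights, dual distance and graph -/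

section Code

variable {F E L : Type*} [Field F] [Field E] [Field L] [Fintype L]
  [Algebra F E] [Algebra F L] [Algebra E L]

theorem traceNormMap_apply (x : L) (d : definingSet F E L 1) :
    traceNormMap F L E L 1 x d = Algebra.trace F L (x * d) := by
  simp [traceNormMap]

theorem weightCount_ne_zero_iff {ι : Type*} [Fintype ι] [Finite F] [DecidableEq F]
    (C : Submodule F (ι → F)) (w : ℕ) :
    weightCount C w ≠ 0 ↔ ∃ c ∈ C, hammingNorm c = w := by
  unfold weightCount
  rw [Nat.card_ne_zero, and_iff_left Subtype.finite]
  constructor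
  · rintro ⟨⟨c, hc⟩, h⟩
    exact ⟨c, hc, by convert h⟩
  · rintro ⟨c, hc, h⟩
    exact ⟨⟨⟨c, hc⟩, by convert h⟩⟩

/-- A vector of the dual code is a linear relation between the elements of the defining set. -/
theorem sum_smul_eq_zero_of_mem_dualCode {v : definingSet F E L 1 → F}
    (hv : v ∈ dualCode (traceNormCode F L E L 1)) : ∑ d, v d • (d : L) = 0 := by
  by_contra hne
  obtain ⟨y, hy⟩ := exists_trace_mul_ne_zero F hne
  refine hy ?_
  have h : v ⬝ᵥ traceNormMap F L E L 1 y = 0 := hv _ (LinearMap.mem_range_self _ y)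
  rw [Finset.sum_mul, map_sum, ← h]
  refine Finset.sum_congr rfl fun d _ => ?_
  rw [traceNormMap_apply, smul_mul_assoc, map_smul, smul_eq_mul, mul_comm y]

variable [IsScalarTower F E L] {q k : ℕ}

/-- A dual word is an `F`-linear relation among elements of `D`. These are nonzero and pairwise
non-proportional, so no nontrivial relation has one or two terms. -/
theorem isProjectiveCode_traceNormCode (hF : Nat.card F = q) (hE : Nat.card E = q ^ 2)
    (hL : Nat.card L = q ^ (2 * k)) (hk : 0 < k) (hgcd : Nat.gcd k (q - 1) = 1) :
    IsProjectiveCode (traceNormCode F L E L 1) := by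
  classical
  intro v hv hv0
  have hsum := sum_smul_eq_zero_of_mem_dualCode hv
  rw [← Finset.sum_filter_of_ne (p := fun d => v d ≠ 0)
    (fun d _ h => fun h0 => h (by rw [h0, zero_smul]))] at hsum
  have hnorm : hammingNorm v = (Finset.univ.filter fun d => v d ≠ 0).card := rfl
  by_contra hlt
  have hlt' : (Finset.univ.filter fun d => v d ≠ 0).card < 3 := by
    rw [← hnorm]
    convert not_le.mp hlt
  have hpos : 0 < (Finset.univ.filter fun d => v d ≠ 0).card := by
    obtain ⟨i, hi⟩ := Function.ne_iff.mp hv0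
    exact Finset.card_pos.mpr ⟨i, by simpa using hi⟩
  have hcases : (Finset.univ.filter fun d => v d ≠ 0).card = 1 ∨
      (Finset.univ.filter fun d => v d ≠ 0).card = 2 := by omega
  have hmem : ∀ d, d ∈ (Finset.univ.filter fun d => v d ≠ 0) → v d ≠ 0 := fun d hd =>
    (Finset.mem_filter.mp hd).2
  rcases hcases with h | h
  · obtain ⟨i, hi⟩ := Finset.card_eq_one.mp h
    rw [hi, Finset.sum_singleton] at hsum
    refine smul_ne_zero (hmem i (by rw [hi]; simp)) ?_ hsum
    exact (mem_definingSet.mp i.2).1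
  · obtain ⟨i, j, hij, hs⟩ := Finset.card_eq_two.mp h
    rw [hs, Finset.sum_pair hij] at hsum
    refine hij (Subtype.ext (eq_of_smul_eq_smul hF hE hL hk hgcd (v := -v j)
      (hmem i (by rw [hs]; simp)) i.2 j.2 ?_).2)
    rw [neg_smul]
    exact eq_neg_of_add_eq_zero_left hsum

theorem card_definingSet_mul (hF : Nat.card F = q) (hE : Nat.card E = q ^ 2)
    (hL : Nat.card L = q ^ (2 * k)) (hk : 0 < k) (hgcd : Nat.gcd k (q - 1) = 1) :
    ((q : ℚ) - 1) * (definingSet F E L 1).card = (traceNormSupport F E L).card := by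
  classical
  have := finite_of_algebra F L
  let := Fintype.ofFinite F
  have h := sum_support_eq hF hE hL hk hgcd (fun _ => (1 : ℚ))
  have h1 := sum_eq_apply_zero_add (fun _ : F => (1 : ℚ))
  simp only [Finset.sum_const, nsmul_eq_mul, mul_one, Finset.card_univ,
    ← Nat.card_eq_fintype_card, hF] at h h1
  rw [h, h1]
  ring

theorem card_definingSet (hF : Nat.card F = q) (hE : Nat.card E = q ^ 2)
    (hL : Nat.card L = q ^ (2 * k)) (hk : 0 < k) (hgcd : Nat.gcd k (q - 1) = 1) :
    ((definingSet F E L 1).card : ℚ) = q * ((q : ℚ) ^ (2 * k) - 1) / ((q : ℚ) ^ 2 - 1) := by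
  have hq : (2 : ℚ) ≤ q := by exact_mod_cast two_le_natCard F L hF
  have h := card_definingSet_mul hF hE hL hk hgcd
  rw [card_traceNormSupport hF hE hL, eq_div_iff (by positivity)] at h
  rw [eq_div_iff (by nlinarith)]
  linear_combination h

open scoped Classical in
/-- The weights of the code in terms of the exponential sums. -/
theorem hammingNorm_traceNormMap (hF : Nat.card F = q) (hE : Nat.card E = q ^ 2)
    (hL : Nat.card L = q ^ (2 * k)) (hk : 0 < k) (hgcd : Nat.gcd k (q - 1) = 1)
    {χ : AddChar F ℂ} (hχ : χ ≠ 1) {z₀ : L} (hz₀ : z₀ ∈ traceNormZeros F E L) {b : L}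
    (hb : b ≠ 0) :
    ((q : ℂ) + 1) * q * hammingNorm (traceNormMap F L E L 1 b) =
      (q : ℂ) ^ (2 * k + 1) + hermSum χ q (b * z₀) := by
  have := finite_of_algebra F L
  let := Fintype.ofFinite F
  have h1 := sum_traceChar_support hF hE hL hχ hz₀ hb
  have h2 := sum_support_eq hF hE hL hk hgcd (fun s => traceChar L χ (b * s))
  -- The `F`-line through `d` contributes `q - 1` if the coordinate at `d` vanishes and `-1`
  -- otherwise, so the sum over the support counts nonzero coordinates.
  have h3 : ∀ d : definingSet F E L 1,
      ∑ u ∈ Finset.univ.filter (fun u : F => u ≠ 0), traceChar L χ (b * (u • (d : L))) =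
        ((q : ℂ) - 1) - q * (if traceNormMap F L E L 1 b d ≠ 0 then 1 else 0) := by
    intro d
    simp only [mul_smul_comm, traceChar_apply, map_smul, smul_eq_mul, traceNormMap_apply]
    have h := AddChar.sum_mulShift (Algebra.trace F L (b * d)) (AddChar.IsPrimitive.of_ne_one hχ)
    rw [sum_eq_apply_zero_add, zero_mul, AddChar.map_zero_eq_one, ← Nat.card_eq_fintype_card,
      hF] at h
    split_ifs at h ⊢ with h0 <;> push_cast at h <;> first | contradiction | linear_combination h
  have hnorm : (hammingNorm (traceNormMap F L E L 1 b) : ℂ) =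
      ∑ d : definingSet F E L 1, if traceNormMap F L E L 1 b d ≠ 0 then 1 else 0 := by
    rw [hammingNorm, Finset.card_filter]
    push_cast
    rfl
  rw [← Finset.sum_coe_sort (definingSet F E L 1), Finset.sum_congr rfl fun d _ => h3 d,
    Finset.sum_sub_distrib, ← Finset.mul_sum, ← hnorm, Finset.sum_const, nsmul_eq_mul,
    Finset.card_univ, Fintype.card_coe] at h2
  have h4 : ((q : ℂ) - 1) * (definingSet F E L 1).card = (traceNormSupport F E L).card := by
    exact_mod_cast card_definingSet_mul hF hE hL hk hgcd
  have h5 : ((traceNormSupport F E L).card : ℂ) * (q + 1) = q * ((q : ℂ) ^ (2 * k) - 1) := by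
    have h := card_traceNormSupport (F := F) (E := E) hF hE hL
    rw [eq_div_iff (by positivity)] at h
    exact_mod_cast h
  linear_combination (q + 1) * h2 - h1 + (q + 1) * h4 + h5

open scoped Classical in
-- In the weight formula the exponential sum has absolute value at most `q ^ (k + 1)`, which is less
-- than `q ^ (2 * k + 1)` because `k > 0`.
theorem hammingNorm_traceNormMap_pos (hF : Nat.card F = q) (hE : Nat.card E = q ^ 2)
    (hL : Nat.card L = q ^ (2 * k)) (hk : 0 < k) (hgcd : Nat.gcd k (q - 1) = 1) {b : L}
    (hb : b ≠ 0) : 0 < hammingNorm (traceNormMap F L E L 1 b) := by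
  have := finite_of_algebra F L
  have hq := two_le_natCard F L hF
  obtain ⟨χ, hχ⟩ := exists_addChar_ne_one F
  obtain ⟨z₀, hz₀⟩ := traceNormZeros_nonempty (L := L) hF hE
  have h := hammingNorm_traceNormMap hF hE hL hk hgcd hχ hz₀ hb
  rw [Nat.pos_iff_ne_zero]
  intro h0
  rw [h0, Nat.cast_zero, mul_zero] at h
  have hq' : (2 : ℤ) ≤ q := by exact_mod_cast hq
  have hx : (2 : ℤ) ≤ (q : ℤ) ^ k := hq'.trans (le_self_pow₀ (by linarith) hk.ne')
  have hxq : (q : ℤ) ^ k < (q : ℤ) ^ (2 * k + 1) := pow_lt_pow_right₀ (by linarith) (by omega)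
  have hxq' : (q : ℤ) ^ (k + 1) < (q : ℤ) ^ (2 * k + 1) :=
    pow_lt_pow_right₀ (by linarith) (by omega)
  have hp : 0 < (q : ℤ) ^ k := by positivity
  have hp' : 0 < (q : ℤ) ^ (k + 1) := by positivity
  rcases hermSum_eq_or hF hL hχ (mul_ne_zero hb (mem_traceNormZeros.mp hz₀).1) with hG | hG
  · rw [hG] at h
    have h' : (0 : ℤ) = (q : ℤ) ^ (2 * k + 1) + (-1) ^ k * (q : ℤ) ^ k := by exact_mod_cast h
    rcases neg_one_pow_eq_or ℤ k with he | he <;> rw [he] at h' <;> linarith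
  · rw [hG] at h
    have h' : (0 : ℤ) = (q : ℤ) ^ (2 * k + 1) + -((-1) ^ k * (q : ℤ) ^ (k + 1)) := by
      exact_mod_cast h
    rcases neg_one_pow_eq_or ℤ k with he | he <;> rw [he] at h' <;> linarith

theorem traceNormMap_injective (hF : Nat.card F = q) (hE : Nat.card E = q ^ 2)
    (hL : Nat.card L = q ^ (2 * k)) (hk : 0 < k) (hgcd : Nat.gcd k (q - 1) = 1) :
    Function.Injective (traceNormMap F L E L 1) := by
  classical
  rw [injective_iff_map_eq_zero]
  intro b h
  by_contra hb
  have := hammingNorm_traceNormMap_pos hF hE hL hk hgcd hb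
  rw [h, hammingNorm_zero] at this
  exact lt_irrefl _ this

theorem finrank_traceNormCode (hF : Nat.card F = q) (hE : Nat.card E = q ^ 2)
    (hL : Nat.card L = q ^ (2 * k)) (hk : 0 < k) (hgcd : Nat.gcd k (q - 1) = 1) :
    Module.finrank F (traceNormCode F L E L 1) = 2 * k := by
  unfold traceNormCode
  rw [LinearMap.finrank_range_of_inj (traceNormMap_injective hF hE hL hk hgcd),
    finrank_eq_of_natCard hF hL]

/-- The weight of the word of `b` is an injective affine function of `hermSum χ q (b * z₀)`, which
takes exactly two values; `b = c / z₀` reaches each of them. -/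
theorem isTwoWeight_traceNormCode (hF : Nat.card F = q) (hE : Nat.card E = q ^ 2)
    (hL : Nat.card L = q ^ (2 * k)) (hk : 0 < k) (hgcd : Nat.gcd k (q - 1) = 1) :
    IsTwoWeight (traceNormCode F L E L 1) := by
  classical
  have := finite_of_algebra F L
  have hq := two_le_natCard F L hF
  have hq' : (2 : ℤ) ≤ q := by exact_mod_cast hq
  have hqC : ((q : ℂ) + 1) * q ≠ 0 := by
    have : (q + 1) * q ≠ 0 := by positivity
    exact_mod_cast this
  obtain ⟨χ, hχ⟩ := exists_addChar_ne_one F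
  obtain ⟨z₀, hz₀⟩ := traceNormZeros_nonempty (L := L) hF hE
  have hz₀0 := (mem_traceNormZeros.mp hz₀).1
  have hw := fun b hb => hammingNorm_traceNormMap (b := b) hF hE hL hk hgcd hχ hz₀ hb
  obtain ⟨⟨c₁, hc₁, h₁⟩, c₂, hc₂, h₂⟩ := exists_hermSum_eq hF hL hχ
  have e₁ := hw (c₁ / z₀) (div_ne_zero hc₁ hz₀0)
  have e₂ := hw (c₂ / z₀) (div_ne_zero hc₂ hz₀0)
  rw [div_mul_cancel₀ _ hz₀0, h₁] at e₁
  rw [div_mul_cancel₀ _ hz₀0, h₂] at e₂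
  unfold IsTwoWeight
  rw [Set.ncard_eq_two]
  refine ⟨hammingNorm (traceNormMap F L E L 1 (c₁ / z₀)),
    hammingNorm (traceNormMap F L E L 1 (c₂ / z₀)), ?_, ?_⟩
  · intro h
    rw [h, e₂] at e₁
    have h' : (q : ℤ) ^ (2 * k + 1) + -((-1) ^ k * (q : ℤ) ^ (k + 1)) =
        (q : ℤ) ^ (2 * k + 1) + (-1) ^ k * (q : ℤ) ^ k := by exact_mod_cast e₁
    have hp : 0 < (q : ℤ) ^ k := by positivity
    have hp' : 0 < (q : ℤ) ^ (k + 1) := by positivity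
    rcases neg_one_pow_eq_or ℤ k with he | he <;> rw [he] at h' <;> linarith
  · ext w
    simp only [Set.mem_ofPred_eq, Set.mem_insert_iff, Set.mem_singleton_iff,
      weightCount_ne_zero_iff]
    constructor
    · rintro ⟨hw1, -, _, ⟨b, rfl⟩, rfl⟩
      have hb : b ≠ 0 := by
        rintro rfl
        rw [map_zero, hammingNorm_zero] at hw1
        omega
      have e := hw b hb
      refine (hermSum_eq_or hF hL hχ (mul_ne_zero hb hz₀0)).imp (fun hG => ?_) fun hG => ?_
      · rw [hG, ← e₁] at e
        exact_mod_cast mul_left_cancel₀ hqC e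
      · rw [hG, ← e₂] at e
        exact_mod_cast mul_left_cancel₀ hqC e
    · have key : ∀ b : L, b ≠ 0 → 1 ≤ hammingNorm (traceNormMap F L E L 1 b) ∧
          hammingNorm (traceNormMap F L E L 1 b) ≤ Fintype.card (definingSet F E L 1) ∧
          ∃ c ∈ traceNormCode F L E L 1,
            hammingNorm c = hammingNorm (traceNormMap F L E L 1 b) := fun b hb =>
        ⟨hammingNorm_traceNormMap_pos hF hE hL hk hgcd hb, hammingNorm_le_card_fintype,
          _, LinearMap.mem_range_self _ b, rfl⟩
      rintro (rfl | rfl)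
      · exact key _ (div_ne_zero hc₁ hz₀0)
      · exact key _ (div_ne_zero hc₂ hz₀0)

/-- The trace form identifies the vertices of the code graph with `L`, and adjacency becomes
`x - y` lying in the support of `Tr ∘ N`. -/
theorem exists_codeGraph_equiv (hF : Nat.card F = q) (hE : Nat.card E = q ^ 2)
    (hL : Nat.card L = q ^ (2 * k)) (hk : 0 < k) (hgcd : Nat.gcd k (q - 1) = 1) :
    ∃ e : Module.Dual F (traceNormCode F L E L 1) ≃ L, ∀ v w,
      (codeGraph (traceNormCode F L E L 1)).Adj v w ↔ e v - e w ∈ traceNormSupport F E L := by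
  have := finite_of_algebra F L
  let B : L ≃ₗ[F] Module.Dual F L :=
    (Algebra.traceForm F L).toDual (traceForm_nondegenerate F L)
  let R : L ≃ₗ[F] traceNormCode F L E L 1 :=
    LinearEquiv.ofInjective _ (traceNormMap_injective hF hE hL hk hgcd)
  let e : Module.Dual F (traceNormCode F L E L 1) ≃ₗ[F] L := R.dualMap.trans B.symm
  -- Pulled back along the encoding, the coordinate at `d` is `x ↦ Tr(x d)`, which the trace form
  -- represents by `d` itself.
  have he : ∀ d : definingSet F E L 1, e (coordFunctional (traceNormCode F L E L 1) d) = d := by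
    intro d
    refine (LinearEquiv.symm_apply_eq B).mpr ?_
    ext x
    change traceNormMap F L E L 1 x d = Algebra.traceForm F L d x
    rw [traceNormMap_apply, Algebra.traceForm_apply, mul_comm]
  refine ⟨e.toEquiv, fun v w => ?_⟩
  change (v ≠ w ∧ ∃ u : F, u ≠ 0 ∧ ∃ i, v - w = u • coordFunctional _ i) ↔ e v - e w ∈ _
  rw [← map_sub]
  constructor
  · rintro ⟨-, u, hu, i, h⟩
    rw [h, map_smul, he]
    exact smul_mem_traceNormSupport hE hL hu (definingSet_subset_support i.2)
  · intro h
    refine ⟨?_, ?_⟩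
    · rintro rfl
      rw [sub_self, map_zero] at h
      exact zero_notMem_traceNormSupport h
    · obtain ⟨u, hu, d, hd, hud⟩ := exists_smul_of_mem_support hF hE hL hk hgcd h
      refine ⟨u, hu, ⟨d, hd⟩, e.injective ?_⟩
      rw [hud, map_smul, he]

end Code

/-! ### A model of the field tower, and the theorem -/

section Existence

theorem exists_field_tower {q k : ℕ} (hq : IsPrimePow q) (hk : 0 < k) :
    ∃ (F E L : Type) (_ : Field F) (_ : Field E) (_ : Field L) (_ : Fintype L)
      (_ : Algebra F E) (_ : Algebra F L) (_ : Algebra E L) (_ : IsScalarTower F E L),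
      Nat.card F = q ∧ Nat.card E = q ^ 2 ∧ Nat.card L = q ^ (2 * k) := by
  obtain ⟨p, n, hp, hn, rfl⟩ := hq
  have : Fact p.Prime := ⟨hp.nat_prime⟩
  have : NeZero k := ⟨hk.ne'⟩
  let F := GaloisField p n
  let E := FiniteField.Extension F p 2
  have : CharP E p := charP_of_injective_algebraMap (algebraMap F E).injective p
  let L := FiniteField.Extension E p k
  let : Algebra F L := Algebra.compHom L (algebraMap F E)
  have hF : Nat.card F = p ^ n := GaloisField.card p n hn.ne'
  have hE : Nat.card E = (p ^ n) ^ 2 := by rw [FiniteField.natCard_extension, hF]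
  exact ⟨F, E, L, inferInstance, inferInstance, inferInstance, Fintype.ofFinite L, inferInstance,
    inferInstance, inferInstance, IsScalarTower.of_algebraMap_eq fun _ => rfl, hF, hE, by
      rw [FiniteField.natCard_extension, hE, pow_mul]⟩

theorem neg_mem_traceNormSupport {F E L : Type*} [Field F] [Field E] [Field L] [Fintype L]
    [Algebra F E] [Algebra F L] [Algebra E L] [IsScalarTower F E L] {q k : ℕ}
    (hE : Nat.card E = q ^ 2) (hL : Nat.card L = q ^ (2 * k)) :
    ∀ s ∈ traceNormSupport F E L, -s ∈ traceNormSupport F E L := fun s hs => by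
  rw [← neg_one_smul F s]
  exact smul_mem_traceNormSupport hE hL (neg_ne_zero.mpr one_ne_zero) hs

end Existence

theorem theorem5p5 (q m : ℕ) (hq : IsPrimePow q) (hm : 0 < m) (h2 : 2 ∣ m)
    (hgcd : Nat.gcd (m / 2) (q - 1) = 1) :
    ∃ K lam mu : ℕ,
      (K : ℚ) = (q : ℚ) * ((q : ℚ) ^ m - 1) / ((q : ℚ) + 1) ∧
      (lam : ℚ) = ((q : ℚ) ^ (m + 2) - 2 * (q : ℚ) ^ 2 - 3 * (q : ℚ)
          - (-1) ^ (m / 2) * (q : ℚ) ^ (m / 2) * (1 - (q : ℚ))) / ((q : ℚ) + 1) ^ 2 ∧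
      (mu : ℚ) = (q : ℚ) * ((q : ℚ) ^ (m / 2) - (-1) ^ (m / 2))
          * ((q : ℚ) ^ (m / 2 + 1) + (-1) ^ (m / 2)) / ((q : ℚ) + 1) ^ 2 ∧
      -- existence of the graph
      (∃ G : SimpleGraph (Fin (q ^ m)), IsStronglyRegular G (q ^ m) K lam mu) ∧
      -- it is the graph of the code with `a = 1`, `m₁ = m`, `m₂ = 2`
      (∀ (F E L : Type*) [Field F] [Field E] [Field L] [Fintype L]
        [Algebra F E] [Algebra F L] [Algebra E L] [IsScalarTower F E L],
        Nat.card F = q → Nat.card E = q ^ 2 → Nat.card L = q ^ m →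
        ((definingSet F E L 1).card : ℚ) = (q : ℚ) * ((q : ℚ) ^ m - 1) / ((q : ℚ) ^ 2 - 1) ∧
        Module.finrank F (traceNormCode F L E L 1) = m ∧
        IsTwoWeight (traceNormCode F L E L 1) ∧
        IsProjectiveCode (traceNormCode F L E L 1) ∧
        IsStronglyRegular (codeGraph (traceNormCode F L E L 1)) (q ^ m) K lam mu) := by
  obtain ⟨k, rfl⟩ := h2
  have hk : 0 < k := by omega
  rw [Nat.mul_div_cancel_left k two_pos] at hgcd ⊢
  obtain ⟨F₀, E₀, L₀, _, _, _, _, _, _, _, _, hF₀, hE₀, hL₀⟩ := exists_field_tower hq hk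
  classical
  obtain ⟨K, lam, mu, hK, hlam, hmu, hK', hlam', hmu', hmu0⟩ :=
    exists_parameters (L := L₀) hF₀ hE₀ hL₀ hk
  refine ⟨K, lam, mu, hK, hlam, hmu, ?_, ?_⟩
  · let e : Fin (q ^ (2 * k)) ≃ L₀ :=
      (Finite.equivFinOfCardEq (by rw [hL₀])).symm
    let G : SimpleGraph (Fin (q ^ (2 * k))) :=
      { Adj := fun v w => e v - e w ∈ traceNormSupport F₀ E₀ L₀
        symm := ⟨fun v w h => by
          rw [← neg_sub]
          exact neg_mem_traceNormSupport hE₀ hL₀ _ h⟩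
        loopless := ⟨fun v h => zero_notMem_traceNormSupport (by rwa [sub_self] at h)⟩ }
    refine ⟨G, ?_⟩
    have h := isStronglyRegular_of_equiv G e (traceNormSupport F₀ E₀ L₀) (fun _ _ => Iff.rfl)
      (neg_mem_traceNormSupport hE₀ hL₀) hK' (by convert hlam') (by convert hmu') hmu0
    rwa [← Nat.card_eq_fintype_card, hL₀] at h
  · intro F E L _ _ _ _ _ _ _ _ hF hE hL
    refine ⟨card_definingSet hF hE hL hk hgcd, finrank_traceNormCode hF hE hL hk hgcd,
      isTwoWeight_traceNormCode hF hE hL hk hgcd, isProjectiveCode_traceNormCode hF hE hL hk hgcd,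
      ?_⟩
    obtain ⟨K₁, lam₁, mu₁, hK₁, hlam₁, hmu₁, hK₁', hlam₁', hmu₁', hmu₁0⟩ :=
      exists_parameters (L := L) hF hE hL hk
    -- The parameters were fixed using the model tower; their closed formulas depend only on `q` and
    -- `k`, so every tower yields the same naturals.
    obtain rfl : K₁ = K := Nat.cast_injective (R := ℚ) (hK₁.trans hK.symm)
    obtain rfl : lam₁ = lam := Nat.cast_injective (R := ℚ) (hlam₁.trans hlam.symm)
    obtain rfl : mu₁ = mu := Nat.cast_injective (R := ℚ) (hmu₁.trans hmu.symm)
    obtain ⟨e, he⟩ := exists_codeGraph_equiv hF hE hL hk hgcd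
    have h := isStronglyRegular_of_equiv _ e (traceNormSupport F E L) he
      (neg_mem_traceNormSupport hE hL) hK₁' (by convert hlam₁') (by convert hmu₁') hmu₁0
    rwa [← Nat.card_eq_fintype_card, hL] at h
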